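/- Let $F,\Delta\ge 0$ be fixed integers. All trees $T=(V,E)$ are finite and unweighted (every edge has length $1$); $T^s$ denotes the symmetric orientation of $T$, in which each edge is replaced by two opposite arcs. For a closed walk $w$ of length $\ell$ in $T$ and an arc $a$ of $T^s$ that $w$ traverses at the steps $i_1<\dots<i_m$, the number of steps between the $y$-th and the $(y+1)$-st traversal of $a$, taken cyclically, is $i_{y+1}-i_y$ for $1\le y<m$ and $i_1+\ell-i_m$ for $y=m$. Polynomial time means polynomial in the size of the input, with numbers written in binary (rationals as numerator and denominator); the polynomial may depend on $F$ and $\Delta$. (1) There is a polynomial-time algorithm that, given a tree $T=(V,E)$ rooted in $d\in V$ of maximum degree at most $\Delta$, a function $f:E\to\mathbb N$ with $f(e)\le F$ for all $e\in E$ and a function $g:E\times\{1,\dots,F\}\to\mathbb N$, decides whether there is a closed walk $w$ starting at $d$ such that (a) $w$ traverses both arcs of every edge $e$ exactly $f(e)$ times each, and (b) for each arc $a$ of $T^s$, with underlying edge $e$, and each $y\le F$ not larger than the number of traversals of $a$ by $w$, there are at most $g(e,y)$ steps between the $y$-th and the $(y+1)$-st traversal of $a$, taken cyclically. The same holds if (a)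 is replaced by the condition that $w$ traverses both arcs of every edge $e$ at most $f(e)$ times each, and also if it is replaced by the condition that $w$ traverses both arcs of every edge $e$ at least once and at most $f(e)$ times each. (2) There is a polynomial-time algorithm that, given a tree $T=(V,E)$ of maximum degree at most $\Delta$ with a depot $d\in V$, an integer $z$, priorities $p:E\to\{1,\dots,z\}$, a maximum route length $L\in\mathbb N$, a rational capacity $0\le c\le 1$, non-negative rational limits $t(k,i)$ for $1\le k\le z$ and $1\le i\le F$, and a function $f:E\to\mathbb N$ with $f(e)\le F$ for all $e\in E$, decides whether an $L,c,t,f$-vehicle route on $T$ exists, that is, a closed walk $w$ starting at $d$ such that: every arc of $T^s$ with underlying edge $e$ is traversed at least once and at most $f(e)$ times; $w$ has at most $L$ steps; for every arc with underlying edge $e$ and every $i$ not larger than its number of traversals, there are at most $t(p(e),i)L$ steps between its $i$-th and $(i+1)$-st traversal, taken cyclically; and every sub-route of $w$ with more than $cL$ steps visits $d$ strictly between its start and its end. -/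

import Mathlib

/-! ## Programs with a step count

Programs work on S-expressions (finite binary trees).  Every elementary operation is charged one
unit plus the number of nodes of the data it is applied to, so that a run with cost `s` can be
carried out by a Turing machine in time polynomial in `s`, and conversely every Turing machine can
be simulated with polynomial overhead. -/

/-- S-expressions: `nil` or a pair of two S-expressions. -/
inductive SExp : Type
  | nil : SExp
  | node : SExp → SExp → SExp

namespace SExp

/-- The number of nodes of an S-expression. -/
def size : SExp → ℕ
  | nil => 1
  | node a b => a.size + b.size + 1

/-- The left component (`nil` has left component `nil`). -/
def head : SExp → SExp
  | nil => nil
  | node a _ => a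

/-- The right component (`nil` has right component `nil`). -/
def tail : SExp → SExp
  | nil => nil
  | node _ b => b

/-- The truth values. -/
def ofBool : Bool → SExp
  | false => nil
  | true => node nil nil

/-- Lists, by iterated pairing. -/
def ofList : List SExp → SExp
  | [] => nil
  | a :: l => node a (ofList l)

/-- Natural numbers are written in binary, least significant bit first. -/
def ofNat (k : ℕ) : SExp := ofList (k.bits.map ofBool)

/-- A non-negative rational number is written as numerator and denominator in lowest terms. -/
def ofNNRat (q : ℚ≥0) : SExp := node (ofNat q.num) (ofNat q.den)

end SExp

/-- Programs, each of which computes a partial function from S-expressions to S-expressions. -/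
inductive Prog : Type
  | nil : Prog
  | id : Prog
  | head : Prog
  | tail : Prog
  | pair : Prog → Prog → Prog
  | comp : Prog → Prog → Prog
  | cond : Prog → Prog → Prog → Prog
  | loop : Prog → Prog → Prog

/-- `p.Runs x y s`: the program `p`, started on the input `x`, halts with output `y` after `s`
steps.  `pair p q` runs `p` and `q` on the input and pairs the results, `comp q p` runs `p` and then
`q`, `cond t p q` runs `p` or `q` according to whether the test `t` yields a pair or `nil`, and
`loop t p` repeats `p` as long as the test `t` yields a pair. -/
inductive Prog.Runs : Prog → SExp → SExp → ℕ → Prop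
  | nil (x : SExp) : Runs .nil x .nil (1 + x.size)
  | id (x : SExp) : Runs .id x x (1 + x.size)
  | head (x : SExp) : Runs .head x x.head (1 + x.size)
  | tail (x : SExp) : Runs .tail x x.tail (1 + x.size)
  | pair {p q : Prog} {x a b : SExp} {s t : ℕ} :
      Runs p x a s → Runs q x b t → Runs (.pair p q) x (.node a b) (s + t + (1 + x.size))
  | comp {q p : Prog} {x y z : SExp} {s t : ℕ} :
      Runs p x y s → Runs q y z t → Runs (.comp q p) x z (s + t + (1 + x.size))
  | condTrue {c p q : Prog} {x a b y : SExp} {s t : ℕ} :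
      Runs c x (.node a b) s → Runs p x y t → Runs (.cond c p q) x y (s + t + (1 + x.size))
  | condFalse {c p q : Prog} {x y : SExp} {s t : ℕ} :
      Runs c x .nil s → Runs q x y t → Runs (.cond c p q) x y (s + t + (1 + x.size))
  | loopDone {c p : Prog} {x : SExp} {s : ℕ} :
      Runs c x .nil s → Runs (.loop c p) x x (s + (1 + x.size))
  | loopStep {c p : Prog} {x a b y z : SExp} {s t u : ℕ} :
      Runs c x (.node a b) s → Runs p x y t → Runs (.loop c p) y z u →
        Runs (.loop c p) x z (s + t + u + (1 + x.size))

/-- The decision problem `P` on instances of type `α`, presented to the program through `enc`, is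
decided by one program that halts on every instance within a number of steps that is polynomial in
the size of the encoded instance. -/
def DecidableInPolyTime {α : Type} (enc : α → SExp) (P : α → Prop) : Prop :=
  ∃ (p : Prog) (q : Polynomial ℕ), ∀ I : α, ∃ (b : Bool) (s : ℕ),
    p.Runs (enc I) (SExp.ofBool b) s ∧ s ≤ q.eval (enc I).size ∧ (b = true ↔ P I)

/-! ## Traversals of arcs by a closed walk

The arcs of the symmetric orientation of a graph are its darts. -/

/-- The positions (counted from `0`) at which the walk `w` traverses the arc `a`, in increasing
order. -/
def traversalTimes {n : ℕ} {G : SimpleGraph (Fin n)} {u v : Fin n} (w : G.Walk u v)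
    (a : G.Dart) : List ℕ :=
  (List.range w.length).filter fun i => w.darts[i]? = some a

/-- The number of times that the walk `w` traverses the arc `a`. -/
def traversalCount {n : ℕ} {G : SimpleGraph (Fin n)} {u v : Fin n} (w : G.Walk u v)
    (a : G.Dart) : ℕ :=
  (traversalTimes w a).length

/-- The number of steps of the closed walk `w` from its traversal number `y` of the arc `a` to the
cyclically next one, where `y < traversalCount w a` and traversals are numbered from `0`: the last
traversal is followed by the first one in the next round of `w`. -/
def traversalGap {n : ℕ} {G : SimpleGraph (Fin n)} {d : Fin n} (w : G.Walk d d)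
    (a : G.Dart) (y : ℕ) : ℕ :=
  (traversalTimes w a).getD (y + 1) ((traversalTimes w a).getD 0 0 + w.length)
    - (traversalTimes w a).getD y 0

/-- The undirected edge underlying an arc. -/
def arcEdge {n : ℕ} {G : SimpleGraph (Fin n)} (a : G.Dart) : G.edgeSet := ⟨a.edge, a.edge_mem⟩

open Classical in
/-- The list of all edges `{u, v}` with `u < v`, in lexicographic order, each written as `u`, `v`
followed by a label. -/
noncomputable def encodeEdges {n : ℕ} (G : SimpleGraph (Fin n)) (label : G.edgeSet → SExp) :
    SExp :=
  SExp.ofList <| (List.finRange n).flatMap fun u => (List.finRange n).filterMap fun v =>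
    if h : u < v ∧ G.Adj u v then
      some (SExp.ofList [SExp.ofNat u, SExp.ofNat v, label ⟨s(u, v), h.2⟩])
    else none

/-! ## The two kinds of instances -/

/-- A rooted tree of maximum degree at most `Δ`. -/
structure BoundedRootedTree (Δ : ℕ) where
  n : ℕ
  T : SimpleGraph (Fin n)
  isTree : T.IsTree
  root : Fin n
  degree_le : ∀ v, (T.neighborSet v).ncard ≤ Δ

/-- A rooted tree with traversal counts `f` and gap bounds `g`; the bound for the traversal number
`y ∈ {1, …, F}` stands at the index `y - 1` of `Fin F`. -/
structure TraversalInstance (F Δ : ℕ) extends BoundedRootedTree Δ where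
  f : T.edgeSet → ℕ
  f_le : ∀ e, f e ≤ F
  g : T.edgeSet → Fin F → ℕ

namespace TraversalInstance

variable {F Δ : ℕ}

noncomputable def encode (I : TraversalInstance F Δ) : SExp :=
  SExp.ofList [SExp.ofNat I.n, SExp.ofNat I.root,
    encodeEdges I.T fun e =>
      SExp.node (SExp.ofNat (I.f e)) (SExp.ofList (List.ofFn fun y => SExp.ofNat (I.g e y)))]

/-- Cyclically consecutive traversals of each arc are separated by at most the prescribed number of
steps. -/
def RespectsGaps (I : TraversalInstance F Δ) (w : I.T.Walk I.root I.root) : Prop :=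
  ∀ (a : I.T.Dart) (y : Fin F), (y : ℕ) < traversalCount w a →
    traversalGap w a y ≤ I.g (arcEdge a) y

end TraversalInstance

/-- An unweighted maintaining plan on a rooted tree in which all edges are maintained, with the
parameters `L`, `c`, `t`, `f`; the value of `t` for the traversal number `i ∈ {1, …, F}` stands at
the index `i - 1` of `Fin F`. -/
structure PlanInstance (F Δ : ℕ) extends BoundedRootedTree Δ where
  z : ℕ
  p : T.edgeSet → Fin z
  L : ℕ
  c : ℚ≥0
  c_le : c ≤ 1
  t : Fin z → Fin F → ℚ≥0
  f : T.edgeSet → ℕ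
  f_le : ∀ e, f e ≤ F

namespace PlanInstance

variable {F Δ : ℕ}

noncomputable def encode (I : PlanInstance F Δ) : SExp :=
  SExp.ofList [SExp.ofNat I.n, SExp.ofNat I.root, SExp.ofNat I.z, SExp.ofNat I.L,
    SExp.ofNNRat I.c,
    SExp.ofList (List.ofFn fun k => SExp.ofList (List.ofFn fun i => SExp.ofNNRat (I.t k i))),
    encodeEdges I.T fun e => SExp.node (SExp.ofNat (I.f e)) (SExp.ofNat (I.p e))]

/-- The `L,c,t,f`-vehicle routes.  The capacity condition says that each sub-route longer than
`c * L` passes through the depot strictly between its start and its end, that is, that the route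
never makes more than `c * L` steps between two consecutive visits to the depot. -/
structure IsVehicleRoute (I : PlanInstance F Δ) (w : I.T.Walk I.root I.root) : Prop where
  covers : ∀ a : I.T.Dart, 1 ≤ traversalCount w a
  frequency : ∀ a : I.T.Dart, traversalCount w a ≤ I.f (arcEdge a)
  length_le : w.length ≤ I.L
  priority : ∀ (a : I.T.Dart) (i : Fin F), (i : ℕ) < traversalCount w a →
    (traversalGap w a i : ℚ≥0) ≤ I.t (I.p (arcEdge a)) i * I.L
  capacity : ∀ i j : ℕ, i < j → j ≤ w.length → I.c * I.L < ((j - i : ℕ) : ℚ≥0) →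
    ∃ k, i < k ∧ k < j ∧ w.getVert k = I.root

end PlanInstance

/-! ## Typed polynomial-time functions -/

/-! The idea is to replace a closed walk by local descriptions, one word per vertex. At each time,
the word of `v` records the neighbour of `v` in the direction of the current position, or `v` itself
when the walk is there. Deleting an edge splits the tree into two sides, so the words of adjacent
vertices satisfy a simple binary condition: at each time exactly one of the two points across their
edge. Conversely, words that satisfy these conditions, change their letter only by passing through
`v`, and start and end at the root come from a closed walk (`IsTree.exists_walk_iff`). The traversal
times of an arc can be read off the word of its tail (`arcTimes_wordOf`), and the visits to the
depot off the word of the root. So every remaining requirement constrains single words.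

There are only polynomially many words to consider. Each departure from `v` uses one of at most `Δ`
arcs, each at most `F` times, so `v` occurs at most `F * Δ + 1` times in its word, counting the
final position. Between these occurrences the word is constant. It is therefore a concatenation of a
fixed number of constant blocks, and the total length is linear in the number of vertices
(`wordOf_mem_candidateWords`).

What remains is a constraint satisfaction problem with polynomial domains and binary constraints
along the edges of a tree. There, arc consistency suffices: candidates without a partner at some
neighbour are deleted until nothing changes, and a surviving candidate at the root extends along
paths to a global solution (`IsTree.exists_solution`, `solve_iff_exists_words`).

For the running time, a small calculus of polynomial-time functions is built over the program model.
Its core is `PolyTime.list_foldl`, which permits a fold if all intermediate values stay polynomially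
small. List operations and binary arithmetic are reduced to such folds. -/

/-- Data types whose elements are written as S-expressions. -/
class Enc (α : Type) where
  enc : α → SExp

open Enc (enc)

instance : Enc Bool := ⟨SExp.ofBool⟩
instance : Enc Unit := ⟨fun _ => .nil⟩
instance : Enc ℕ := ⟨SExp.ofNat⟩
instance {α β : Type} [Enc α] [Enc β] : Enc (α × β) := ⟨fun x => .node (enc x.1) (enc x.2)⟩
instance {α : Type} [Enc α] : Enc (List α) := ⟨fun l => .ofList (l.map enc)⟩

/-- The number of nodes of the encoding. -/
def esize {α : Type} [Enc α] (a : α) : ℕ := (enc a).size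

theorem SExp.one_le_size (x : SExp) : 1 ≤ x.size := by
  cases x <;> simp [SExp.size]

theorem SExp.size_head_le (x : SExp) : x.head.size ≤ x.size := by
  cases x <;> simp [SExp.size, SExp.head]; omega

theorem SExp.size_tail_le (x : SExp) : x.tail.size ≤ x.size := by
  cases x <;> simp [SExp.size, SExp.tail]; omega

/-- Elementary operations are charged more than the size of their input, and none produces more than
it reads or a single node. Time bounds therefore also bound sizes, which is what composition needs.
-/
theorem Prog.Runs.size_le {p : Prog} {x y : SExp} {s : ℕ} (h : p.Runs x y s) : y.size ≤ s := by
  induction h with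
  | nil x => simp [SExp.size]
  | id x => omega
  | head x => have := x.size_head_le; omega
  | tail x => have := x.size_tail_le; omega
  | pair _ _ h1 h2 => simp [SExp.size]; omega
  | comp _ _ _ h2 => omega
  | condTrue _ _ _ h2 => omega
  | condFalse _ _ _ h2 => omega
  | loopDone _ _ => omega
  | loopStep _ _ _ _ _ h => omega

theorem Polynomial.eval_le_eval_of_le (q : Polynomial ℕ) {m n : ℕ} (h : m ≤ n) :
    q.eval m ≤ q.eval n := by
  rw [Polynomial.eval_eq_sum_range, Polynomial.eval_eq_sum_range]
  exact Finset.sum_le_sum fun i _ => Nat.mul_le_mul_left _ (Nat.pow_le_pow_left h i)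

/-- The function `f` is computed by a program within a number of steps that is polynomial in the
size of the input. -/
@[fun_prop]
def PolyTime {α β : Type} [Enc α] [Enc β] (f : α → β) : Prop :=
  ∃ (p : Prog) (q : Polynomial ℕ), ∀ a, ∃ s, p.Runs (enc a) (enc (f a)) s ∧ s ≤ q.eval (esize a)

/-! ### Closure properties of polynomial-time functions -/

section Basic

variable {α β γ δ σ : Type} [Enc α] [Enc β] [Enc γ] [Enc δ] [Enc σ]

theorem one_le_esize (a : α) : 1 ≤ esize a := SExp.one_le_size _

@[simp] theorem esize_pair (a : α) (b : β) : esize (a, b) = esize a + esize b + 1 := rfl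

@[simp] theorem esize_nil : esize ([] : List α) = 1 := rfl

@[simp] theorem esize_cons (a : α) (l : List α) : esize (a :: l) = esize a + esize l + 1 := rfl

theorem esize_append (l m : List α) : esize (l ++ m) + 1 = esize l + esize m := by
  induction l with
  | nil => simp; omega
  | cons a l ih => simp; omega

theorem esize_le_of_sublist {l m : List α} (h : l.Sublist m) : esize l ≤ esize m := by
  induction h with
  | slnil => rfl
  | cons a _ ih => simp; omega
  | cons_cons a _ ih => simp; omega

theorem esize_le_of_mem {l : List α} {a : α} (h : a ∈ l) : esize a ≤ esize l := by
  have := esize_le_of_sublist (List.singleton_sublist.2 h)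
  simp at this; omega

theorem length_lt_esize (l : List α) : l.length < esize l := by
  induction l with
  | nil => simp
  | cons a l ih => have := one_le_esize a; simp; omega

theorem esize_bool_le (b : Bool) : esize b ≤ 3 := by
  cases b
  · exact (by decide : 1 ≤ 3)
  · exact le_refl 3

theorem PolyTime.esize_le {f : α → β} (hf : PolyTime f) :
    ∃ q : Polynomial ℕ, ∀ a, esize (f a) ≤ q.eval (esize a) := by
  obtain ⟨p, q, h⟩ := hf
  refine ⟨q, fun a => ?_⟩
  obtain ⟨s, h1, h2⟩ := h a
  exact h1.size_le.trans h2

/-- Polynomial time is preserved if the result is read as an element of another type with the same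
encoding. -/
theorem PolyTime.of_enc_eq {f : α → β} {g : α → γ} (hf : PolyTime f)
    (h : ∀ a, enc (g a) = enc (f a)) : PolyTime g := by
  obtain ⟨p, q, hp⟩ := hf
  exact ⟨p, q, fun a => by rw [h]; exact hp a⟩

theorem PolyTime.congr {f g : α → β} (hf : PolyTime f) (h : ∀ a, g a = f a) : PolyTime g :=
  hf.of_enc_eq fun a => by rw [h]

@[fun_prop]
theorem PolyTime.id : PolyTime (fun a : α => a) :=
  ⟨.id, 1 + .X, fun a => ⟨_, .id _, by simp [esize]⟩⟩

theorem Prog.exists_const (x : SExp) : ∃ (p : Prog) (q : Polynomial ℕ), ∀ y, ∃ s,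
    p.Runs y x s ∧ s ≤ q.eval y.size := by
  induction x with
  | nil => exact ⟨.nil, 1 + .X, fun y => ⟨_, .nil _, by simp⟩⟩
  | node a b ha hb =>
    obtain ⟨p, q, h⟩ := ha
    obtain ⟨p', q', h'⟩ := hb
    refine ⟨.pair p p', q + q' + (1 + .X), fun y => ?_⟩
    obtain ⟨s, h1, h2⟩ := h y
    obtain ⟨t, h3, h4⟩ := h' y
    exact ⟨_, .pair h1 h3, by simp; omega⟩

@[fun_prop]
theorem PolyTime.const (c : β) : PolyTime (fun _ : α => c) := by
  obtain ⟨p, q, h⟩ := Prog.exists_const (enc c)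
  exact ⟨p, q, fun a => h _⟩

@[fun_prop]
theorem PolyTime.comp {g : β → γ} {f : α → β} (hg : PolyTime g) (hf : PolyTime f) :
    PolyTime (fun a => g (f a)) := by
  obtain ⟨p, q, h⟩ := hf
  obtain ⟨p', q', h'⟩ := hg
  refine ⟨.comp p' p, q + q'.comp q + (1 + .X), fun a => ?_⟩
  obtain ⟨s, h1, h2⟩ := h a
  obtain ⟨t, h3, h4⟩ := h' (f a)
  refine ⟨_, .comp h1 h3, ?_⟩
  have : esize (f a) ≤ q.eval (esize a) := h1.size_le.trans h2
  have := q'.eval_le_eval_of_le this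
  simp only [esize, Polynomial.eval_add, Polynomial.eval_comp, Polynomial.eval_one,
    Polynomial.eval_X] at *
  omega

@[fun_prop]
theorem PolyTime.prodMk {f : α → β} {g : α → γ} (hf : PolyTime f) (hg : PolyTime g) :
    PolyTime (fun a => (f a, g a)) := by
  obtain ⟨p, q, h⟩ := hf
  obtain ⟨p', q', h'⟩ := hg
  refine ⟨.pair p p', q + q' + (1 + .X), fun a => ?_⟩
  obtain ⟨s, h1, h2⟩ := h a
  obtain ⟨t, h3, h4⟩ := h' a
  exact ⟨_, .pair h1 h3, by simp [esize] at *; omega⟩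

theorem PolyTime.of_head {f : α → β} (h : ∀ a, enc (f a) = (enc a).head) : PolyTime f :=
  ⟨.head, 1 + .X, fun a => ⟨_, by rw [h]; exact .head _, by simp [esize]⟩⟩

theorem PolyTime.of_tail {f : α → β} (h : ∀ a, enc (f a) = (enc a).tail) : PolyTime f :=
  ⟨.tail, 1 + .X, fun a => ⟨_, by rw [h]; exact .tail _, by simp [esize]⟩⟩

@[fun_prop]
theorem PolyTime.fst {f : α → β × γ} (hf : PolyTime f) : PolyTime (fun a => (f a).1) :=
  PolyTime.comp (g := Prod.fst) (.of_head fun _ => rfl) hf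

@[fun_prop]
theorem PolyTime.snd {f : α → β × γ} (hf : PolyTime f) : PolyTime (fun a => (f a).2) :=
  PolyTime.comp (g := Prod.snd) (.of_tail fun _ => rfl) hf

@[fun_prop]
theorem PolyTime.list_cons {f : α → β} {g : α → List β} (hf : PolyTime f) (hg : PolyTime g) :
    PolyTime (fun a => f a :: g a) :=
  (hf.prodMk hg).of_enc_eq fun _ => rfl

@[fun_prop]
theorem PolyTime.list_tail {f : α → List β} (hf : PolyTime f) : PolyTime (fun a => (f a).tail) :=
  PolyTime.comp (g := List.tail) (.of_tail fun l => by cases l <;> rfl) hf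

/-- Case distinction by a test that is read off the encoding of some value. -/
theorem PolyTime.cond_of_enc {t : α → β} {c : α → Bool} {f g : α → γ} (ht : PolyTime t)
    (hc : ∀ a, c a = false ↔ enc (t a) = .nil) (hf : PolyTime f) (hg : PolyTime g) :
    PolyTime (fun a => bif c a then f a else g a) := by
  obtain ⟨p, q, h⟩ := hf
  obtain ⟨p', q', h'⟩ := hg
  obtain ⟨p'', q'', h''⟩ := ht
  refine ⟨.cond p'' p p', q + q' + q'' + (1 + .X), fun a => ?_⟩
  obtain ⟨s, h1, h2⟩ := h a
  obtain ⟨t, h3, h4⟩ := h' a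
  obtain ⟨u, h5, h6⟩ := h'' a
  cases hca : c a with
  | false =>
    rw [(hc a).1 hca] at h5
    simp only [hca, cond_false]
    exact ⟨_, .condFalse h5 h3, by simp [esize] at *; omega⟩
  | true =>
    rcases hta : enc (_ : β) with _ | ⟨x, y⟩
    · exact absurd ((hc a).2 hta) (by simp [hca])
    · rw [hta] at h5
      simp only [hca, cond_true]
      exact ⟨_, .condTrue h5 h1, by simp [esize] at *; omega⟩

@[fun_prop]
theorem PolyTime.cond {c : α → Bool} {f g : α → β} (hc : PolyTime c) (hf : PolyTime f)
    (hg : PolyTime g) : PolyTime (fun a => bif c a then f a else g a) :=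
  hc.cond_of_enc (fun a => by cases c a <;> simp [enc, SExp.ofBool]) hf hg

@[fun_prop]
theorem PolyTime.not {f : α → Bool} (hf : PolyTime f) : PolyTime (fun a => !f a) :=
  (hf.cond (.const false) (.const true)).congr fun a => by cases f a <;> rfl

@[fun_prop]
theorem PolyTime.and {f g : α → Bool} (hf : PolyTime f) (hg : PolyTime g) :
    PolyTime (fun a => f a && g a) :=
  (hf.cond hg (.const false)).congr fun a => by cases f a <;> rfl

@[fun_prop]
theorem PolyTime.or {f g : α → Bool} (hf : PolyTime f) (hg : PolyTime g) :
    PolyTime (fun a => f a || g a) :=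
  (hf.cond (.const true) hg).congr fun a => by cases f a <;> rfl

@[fun_prop]
theorem PolyTime.xor {f g : α → Bool} (hf : PolyTime f) (hg : PolyTime g) :
    PolyTime (fun a => f a ^^ g a) :=
  (hf.cond hg.not hg).congr fun a => by cases f a <;> cases g a <;> rfl

@[fun_prop]
theorem PolyTime.list_isEmpty {f : α → List β} (hf : PolyTime f) :
    PolyTime (fun a => (f a).isEmpty) :=
  (hf.cond_of_enc (c := fun a => !(f a).isEmpty) (g := fun _ => true)
    (fun a => by cases f a <;> simp [enc, SExp.ofList]) (.const false)
    (.const true)).congr fun a => by cases f a <;> rfl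

@[fun_prop]
theorem PolyTime.list_headD {f : α → List β} {g : α → β} (hf : PolyTime f) (hg : PolyTime g) :
    PolyTime (fun a => (f a).headD (g a)) := by
  have h : PolyTime (fun x : List β × β => x.1.headD x.2) := by
    -- The program works on the pair of list and default: it extracts the list, takes its head if
    -- there is one, and otherwise returns the second component of the pair.
    obtain ⟨p, q, hp⟩ := (PolyTime.id (α := List β × β)).fst
    refine ⟨.cond p (.comp .head p) .tail, q + (q + (1 + q) + (1 + .X)) + (1 + .X) + (1 + .X),
      fun x => ?_⟩
    obtain ⟨s, h1, h2⟩ := hp x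
    have h3 : (enc x.1).size ≤ s := h1.size_le
    obtain ⟨_ | ⟨b, l⟩, c⟩ := x
    · exact ⟨_, .condFalse h1 (.tail _), by simp [esize] at *; omega⟩
    · exact ⟨_, .condTrue h1 (.comp h1 (.head _)), by simp [esize] at *; omega⟩
  exact h.comp (hf.prodMk hg)

@[fun_prop]
theorem PolyTime.list_getD {f : α → List β} {g : α → β} (hf : PolyTime f) (i : ℕ)
    (hg : PolyTime g) : PolyTime (fun a => (f a).getD i (g a)) := by
  induction i generalizing f with
  | zero => exact (hf.list_headD hg).congr fun a => by cases f a <;> rfl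
  | succ i ih => exact (ih hf.list_tail).congr fun a => by cases f a <;> simp

/-- Folds over lists in which all intermediate results have polynomial size. -/
theorem PolyTime.list_foldl {l : α → List β} {init : α → σ} {step : α → σ → β → σ}
    (hl : PolyTime l) (hi : PolyTime init)
    (hs : PolyTime (fun x : α × σ × β => step x.1 x.2.1 x.2.2)) (r : Polynomial ℕ)
    (hr : ∀ a m, m <+: l a → esize (m.foldl (step a) (init a)) ≤ r.eval (esize a)) :
    PolyTime (fun a => (l a).foldl (step a) (init a)) := by
  obtain ⟨pt, qt, ht⟩ : PolyTime (fun x : α × σ × List β => x.2.2) := by fun_prop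
  -- The loop state consists of the context, the accumulator and the unread part of the list. One
  -- iteration consumes one element; apart from the run of `step`, it is a bounded number of
  -- projections and pairings on parts of the state.
  obtain ⟨p, q, hp⟩ : ∃ (p : Prog) (q : Polynomial ℕ), ∀ a s b m, ∃ t,
      p.Runs (enc (a, s, b :: m)) (enc (a, step a s b, m)) t ∧
        t ≤ q.eval (esize (a, s, b :: m)) := by
    obtain ⟨p1, q1, h1⟩ := hs
    refine ⟨.pair .head (.pair (.comp p1 (.pair .head (.pair (.comp .head .tail)
      (.comp .head (.comp .tail .tail))))) (.comp .tail (.comp .tail .tail))), 20 * (1 + .X) + q1,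
      fun a s b m => ?_⟩
    obtain ⟨t, h2, h3⟩ := h1 (a, s, b)
    refine ⟨_, .pair (.head _) (.pair (.comp (.pair (.head _) (.pair (.comp (.tail _) (.head _))
      (.comp (.comp (.tail _) (.tail _)) (.head _)))) h2)
      (.comp (.comp (.tail _) (.tail _)) (.tail _))), ?_⟩
    have h4 : q1.eval (esize (a, s, b)) ≤ q1.eval (esize (a, s, b :: m)) :=
      q1.eval_le_eval_of_le (by simp; omega)
    have e1 : (enc (a, s, b :: m)).size = esize (a, s, b :: m) := rfl
    have e2 : (enc (a, s, b :: m)).tail.size = esize s + esize (b :: m) + 1 := rfl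
    have e3 : (enc (a, s, b :: m)).tail.tail.size = esize (b :: m) := rfl
    simp only [Polynomial.eval_add, Polynomial.eval_mul, Polynomial.eval_ofNat,
      Polynomial.eval_one, Polynomial.eval_X, e1, e2, e3]
    simp only [esize_pair, esize_cons] at *
    omega
  -- The bound `M` is imposed with the whole of `m` in the last component, although the state holds
  -- only a suffix of it. In this form the hypothesis passes to the tail of the list in the
  -- induction.
  have key : ∀ (a : α) (M : ℕ) (m : List β) (s : σ),
      (∀ m', m' <+: m → esize (a, m'.foldl (step a) s, m) ≤ M) →
      ∃ t, (Prog.loop pt p).Runs (enc (a, s, m)) (enc (a, m.foldl (step a) s, ([] : List β))) t ∧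
        t ≤ (m.length + 1) * (qt.eval M + q.eval M + (1 + M)) := by
    intro a M m
    induction m with
    | nil =>
      intro s hM
      obtain ⟨t, h1, h2⟩ := ht (a, s, [])
      refine ⟨_, .loopDone h1, ?_⟩
      have h3 := hM [] List.nil_prefix
      have h4 := qt.eval_le_eval_of_le h3
      have h5 : (enc (a, s, ([] : List β))).size ≤ M := h3
      simp only [List.foldl_nil] at *
      simp
      omega
    | cons b m ih =>
      intro s hM
      obtain ⟨t, h1, h2⟩ := ht (a, s, b :: m)
      obtain ⟨u, h3, h4⟩ := hp a s b m
      obtain ⟨v, h5, h6⟩ := ih (step a s b) fun m' hm' => by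
        have := hM (b :: m') (List.cons_prefix_cons.2 ⟨rfl, hm'⟩)
        simp at this ⊢
        omega
      refine ⟨_, .loopStep h1 h3 h5, ?_⟩
      have h7 := hM [] List.nil_prefix
      have h8 := qt.eval_le_eval_of_le h7
      have h9 := q.eval_le_eval_of_le h7
      have h10 : (enc (a, s, b :: m)).size ≤ M := h7
      simp only [List.foldl_nil] at *
      rw [List.length_cons, add_mul _ 1, one_mul]
      omega
  obtain ⟨ql, hql⟩ := hl.esize_le
  have hstart : PolyTime (fun a => (a, init a, l a)) := by fun_prop
  obtain ⟨p0, q0, h0⟩ := hstart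
  let Q : Polynomial ℕ := .X + r + ql + 2
  let C : Polynomial ℕ := (ql + 1) * (qt.comp Q + q.comp Q + (1 + Q))
  refine ⟨.comp (.comp .head .tail) (.comp (.loop pt p) p0),
    (q0 + C + (1 + .X)) + (1 + Q + (1 + Q) + (1 + Q)) + (1 + .X), fun a => ?_⟩
  obtain ⟨s0, h1, h2⟩ := h0 a
  have hQ : ∀ m', m' <+: l a → esize (a, m'.foldl (step a) (init a), l a) ≤ Q.eval (esize a) := by
    intro m' hm'
    have e1 := hr a m' hm'
    have e2 := hql a
    simp [Q]
    omega
  obtain ⟨t, h3, h4⟩ := key a (Q.eval (esize a)) (l a) (init a) hQ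
  refine ⟨_, .comp (.comp h1 h3) (.comp (.tail _) (.head _)), ?_⟩
  have h5 : (l a).length + 1 ≤ ql.eval (esize a) + 1 := by
    have := length_lt_esize (l a)
    have := hql a
    omega
  have h6 := h4.trans (Nat.mul_le_mul_right _ h5)
  have h7 : t ≤ C.eval (esize a) := by
    simpa only [C, Polynomial.eval_mul, Polynomial.eval_add, Polynomial.eval_comp,
      Polynomial.eval_one] using h6
  have h8 : esize (a, (l a).foldl (step a) (init a), ([] : List β)) ≤ Q.eval (esize a) := by
    refine le_trans ?_ (hQ (l a) List.prefix_rfl)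
    have := one_le_esize (l a)
    simp
    omega
  have h9 : (enc (a, (l a).foldl (step a) (init a), ([] : List β))).size ≤ Q.eval (esize a) := h8
  have h10 := (SExp.size_tail_le (enc (a, (l a).foldl (step a) (init a), ([] : List β)))).trans h9
  have h11 : (enc a).size = esize a := rfl
  simp only [Polynomial.eval_add, Polynomial.eval_one, Polynomial.eval_X] at *
  omega

/-- Folds over lists in which each step increases the size only by an amount that depends on the
context and the list element. -/
theorem PolyTime.list_foldl_of_growth {l : α → List β} {init : α → σ} {step : α → σ → β → σ}
    (hl : PolyTime l) (hi : PolyTime init)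
    (hs : PolyTime (fun x : α × σ × β => step x.1 x.2.1 x.2.2)) (q : Polynomial ℕ)
    (hq : ∀ a s b, esize (step a s b) ≤ esize s + q.eval (esize a + esize b)) :
    PolyTime (fun a => (l a).foldl (step a) (init a)) := by
  obtain ⟨ql, hql⟩ := hl.esize_le
  obtain ⟨qi, hqi⟩ := hi.esize_le
  refine hl.list_foldl hi hs (qi + ql * q.comp (.X + ql)) fun a m hm => ?_
  have key : ∀ (m : List β) (s : σ), (∀ b ∈ m, b ∈ l a) →
      esize (m.foldl (step a) s) ≤ esize s + m.length * q.eval (esize a + esize (l a)) := by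
    intro m
    induction m with
    | nil => simp
    | cons b m ih =>
      intro s hm
      have h1 := ih (step a s b) fun b' hb' => hm b' (List.mem_cons_of_mem _ hb')
      have h2 := hq a s b
      have h3 := q.eval_le_eval_of_le
        (Nat.add_le_add_left (esize_le_of_mem (hm b List.mem_cons_self)) (esize a))
      simp only [List.foldl_cons, List.length_cons, add_mul, one_mul]
      omega
  have h1 := key m (init a) fun b hb => hm.subset hb
  have h2 : m.length ≤ ql.eval (esize a) := by
    have := hm.length_le
    have := length_lt_esize (l a)
    have := hql a
    omega
  have h3 := q.eval_le_eval_of_le (Nat.add_le_add_left (hql a) (esize a))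
  have h4 := Nat.mul_le_mul h2 h3
  have h5 := hqi a
  simp only [Polynomial.eval_add, Polynomial.eval_mul, Polynomial.eval_comp, Polynomial.eval_X]
  have h6 : m.length * q.eval (esize a + esize (l a)) ≤
      ql.eval (esize a) * q.eval (esize a + ql.eval (esize a)) := h4
  omega

end Basic

/-! ## List functions -/

/-- The state holds the unread part of the second list and the reversed result. The default letter
never enters the result, since the step does nothing once the second list is exhausted. -/
theorem List.foldl_zip_state {β γ : Type} [Inhabited γ] (l : List β) (m : List γ)
    (acc : List (β × γ)) :
    (l.foldl (fun (s : List γ × List (β × γ)) b => bif s.1.isEmpty then s else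
      (s.1.tail, (b, s.1.headD default) :: s.2)) (m, acc)).2 = (l.zip m).reverse ++ acc := by
  induction l generalizing m acc with
  | nil => simp
  | cons b l ih =>
    cases m with
    | nil => simpa using ih [] acc
    | cons c m => simpa using ih m ((b, c) :: acc)

theorem List.foldl_zipIdx_state {β : Type} (l : List β) (i : ℕ) (acc : List (β × ℕ)) :
    l.foldl (fun (s : ℕ × List (β × ℕ)) b => (s.1 + 1, s.2 ++ [(b, s.1)])) (i, acc) =
      (i + l.length, acc ++ l.zipIdx i) := by
  induction l generalizing i acc with
  | nil => simp
  | cons b l ih => simp [ih]; omega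

section Lists

variable {α β γ δ σ : Type} [Enc α] [Enc β] [Enc γ] [Enc δ] [Enc σ]

@[fun_prop]
theorem PolyTime.list_reverse {l : α → List β} (hl : PolyTime l) :
    PolyTime (fun a => (l a).reverse) := by
  have h : PolyTime fun a => (l a).foldl (fun acc b => b :: acc) [] :=
    hl.list_foldl_of_growth (.const _) (step := fun _ acc b => b :: acc) (by fun_prop) (.X + 1)
      fun a s b => by simp; omega
  exact h.congr fun a => by simp

@[fun_prop]
theorem PolyTime.list_append {l m : α → List β} (hl : PolyTime l) (hm : PolyTime m) :
    PolyTime (fun a => l a ++ m a) := by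
  have h : PolyTime fun a => (l a).reverse.foldl (fun acc b => b :: acc) (m a) :=
    hl.list_reverse.list_foldl_of_growth hm (step := fun _ acc b => b :: acc) (by fun_prop)
      (.X + 1) fun a s b => by simp; omega
  exact h.congr fun a => by simp

@[fun_prop]
theorem PolyTime.list_flatMap {l : α → List β} {g : α → β → List γ} (hl : PolyTime l)
    (hg : PolyTime (fun x : α × β => g x.1 x.2)) : PolyTime (fun a => (l a).flatMap (g a)) := by
  obtain ⟨q, hq⟩ := hg.esize_le
  have h : PolyTime fun a => (l a).foldl (fun acc b => acc ++ g a b) [] := by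
    refine hl.list_foldl_of_growth (.const _) (step := fun a acc b => acc ++ g a b)
      ?_ (q.comp (.X + 1)) fun a s b => ?_
    · have h1 : PolyTime fun x : α × List γ × β => g x.1 x.2.2 :=
        PolyTime.comp hg (f := fun x : α × List γ × β => (x.1, x.2.2)) (by fun_prop)
      fun_prop
    · have h1 := hq (a, b)
      have h2 := esize_append s (g a b)
      simp at *
      omega
  exact h.congr fun a => by simp [List.flatMap_eq_foldl]

@[fun_prop]
theorem PolyTime.list_map {l : α → List β} {g : α → β → γ} (hl : PolyTime l)
    (hg : PolyTime (fun x : α × β => g x.1 x.2)) : PolyTime (fun a => (l a).map (g a)) := by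
  have h : PolyTime fun a => (l a).flatMap fun b => [g a b] :=
    hl.list_flatMap (hg.list_cons (.const _))
  exact h.congr fun a => by simp [List.map_eq_flatMap]

@[fun_prop]
theorem PolyTime.list_filter {l : α → List β} {g : α → β → Bool} (hl : PolyTime l)
    (hg : PolyTime (fun x : α × β => g x.1 x.2)) : PolyTime (fun a => (l a).filter (g a)) := by
  have h : PolyTime fun a => (l a).flatMap fun b => bif g a b then [b] else [] :=
    hl.list_flatMap (hg.cond (by fun_prop) (by fun_prop))
  refine h.congr fun a => ?_
  induction l a with
  | nil => rfl
  | cons b m ih => cases hb : g a b <;> simp [hb, ih]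

@[fun_prop]
theorem PolyTime.list_any {l : α → List β} {g : α → β → Bool} (hl : PolyTime l)
    (hg : PolyTime (fun x : α × β => g x.1 x.2)) : PolyTime (fun a => (l a).any (g a)) := by
  have h : PolyTime fun a => !((l a).filter (g a)).isEmpty := by fun_prop
  refine h.congr fun a => ?_
  induction l a with
  | nil => rfl
  | cons b m ih => cases hb : g a b <;> simp [hb, ih]

@[fun_prop]
theorem PolyTime.list_all {l : α → List β} {g : α → β → Bool} (hl : PolyTime l)
    (hg : PolyTime (fun x : α × β => g x.1 x.2)) : PolyTime (fun a => (l a).all (g a)) := by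
  have h : PolyTime fun a => !((l a).any fun b => !g a b) := by fun_prop
  exact h.congr fun a => by simp [List.all_eq_not_any_not]

/-- Since `k` is fixed, the conjunction can be written out in the program, and no uniformity of the
tests in `i` is needed. This is used with `k = F`. -/
theorem PolyTime.forall_lt {p : α → ℕ → Bool} (k : ℕ) (hp : ∀ i, PolyTime fun a => p a i) :
    PolyTime (fun a => (List.range k).all (p a)) := by
  induction k with
  | zero => exact (PolyTime.const true).congr fun a => by simp
  | succ k ih => exact (ih.and (hp k)).congr fun a => by simp [List.range_succ]

@[fun_prop]
theorem PolyTime.list_zip [Inhabited γ] {l : α → List β} {m : α → List γ} (hl : PolyTime l)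
    (hm : PolyTime m) : PolyTime (fun a => (l a).zip (m a)) := by
  have h : PolyTime fun a => (l a).foldl (fun (s : List γ × List (β × γ)) b =>
      bif s.1.isEmpty then s else (s.1.tail, (b, s.1.headD default) :: s.2)) (m a, []) := by
    refine hl.list_foldl_of_growth (by fun_prop) (step := fun _ (s : List γ × List (β × γ)) b =>
      bif s.1.isEmpty then s else
      (s.1.tail, (b, s.1.headD default) :: s.2)) (by fun_prop) (.X + 2) fun a s b => ?_
    obtain ⟨_ | ⟨c, m⟩, acc⟩ := s
    · simp
    · simp; omega
  exact h.snd.list_reverse.congr fun a => by rw [List.foldl_zip_state]; simp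

end Lists

/-! ## Arithmetic in binary -/

section Arithmetic

variable {α β : Type} [Enc α] [Enc β]

-- A number and the list of its bits have the same encoding, so arithmetic becomes list processing.
@[fun_prop]
theorem PolyTime.nat_bits {f : α → ℕ} (hf : PolyTime f) : PolyTime (fun a => (f a).bits) :=
  hf.of_enc_eq fun _ => rfl

@[fun_prop]
theorem PolyTime.nat_bodd {f : α → ℕ} (hf : PolyTime f) : PolyTime (fun a => (f a).bodd) :=
  (hf.nat_bits.list_headD (.const false)).congr fun a => by
    rw [Nat.bodd_eq_bits_head]; cases (f a).bits <;> rfl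

@[fun_prop]
theorem PolyTime.nat_div2 {f : α → ℕ} (hf : PolyTime f) : PolyTime (fun a => (f a).div2) :=
  hf.nat_bits.list_tail.of_enc_eq fun a => by
    rw [← Nat.div2_bits_eq_tail]; rfl

@[fun_prop]
theorem PolyTime.nat_bit {b : α → Bool} {f : α → ℕ} (hb : PolyTime b) (hf : PolyTime f) :
    PolyTime (fun a => Nat.bit (b a) (f a)) := by
  -- Prepending a zero bit to the number zero must give the empty bit list, since encodings have no
  -- leading zeros.
  have h : PolyTime fun a => bif b a || !(f a).bits.isEmpty then b a :: (f a).bits else [] := by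
    fun_prop
  refine h.of_enc_eq fun a => ?_
  rcases Nat.eq_zero_or_pos (f a) with h0 | h0
  · cases hba : b a
    · simp [h0]; rfl
    · simp [h0]; rfl
  · have h1 : (f a).bits ≠ [] := by
      intro h1
      have h2 := Nat.size_eq_bits_len (f a)
      rw [h1, List.length_nil, eq_comm, Nat.size_eq_zero] at h2
      omega
    have h2 : (f a).bits.isEmpty = false := by simpa using h1
    rw [h2, show enc (Nat.bit (b a) (f a)) = enc (Nat.bits (Nat.bit (b a) (f a))) from rfl,
      Nat.bits_append_bit _ _ (by omega)]
    simp

theorem esize_nat (k : ℕ) : esize k = esize k.bits := rfl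

theorem esize_nat_le (k : ℕ) : esize k ≤ 4 * Nat.size k + 1 := by
  rw [esize_nat, ← Nat.size_eq_bits_len]
  induction k.bits with
  | nil => simp
  | cons b l ih => have := esize_bool_le b; simp; omega

theorem Nat.size_le_esize (k : ℕ) : Nat.size k ≤ esize k := by
  rw [esize_nat, ← Nat.size_eq_bits_len]
  exact (length_lt_esize _).le

/-- The number with the given binary digits, least significant bit first. -/
def Nat.ofBitList (l : List Bool) : ℕ := l.foldr Nat.bit 0

@[simp] theorem Nat.ofBitList_bits (k : ℕ) : Nat.ofBitList k.bits = k := by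
  induction k using Nat.binaryRec' with
  | zero => rfl
  | bit b n h ih =>
    rw [Nat.bits_append_bit _ _ h]
    exact congrArg (Nat.bit b) ih

theorem Nat.size_bit_le (b : Bool) (n : ℕ) : Nat.size (Nat.bit b n) ≤ Nat.size n + 1 := by
  rw [Nat.size_le, pow_succ]
  have := Nat.lt_size_self n
  cases b <;> simp [Nat.bit] <;> omega

theorem Nat.size_ofBitList_le (l : List Bool) : Nat.size (Nat.ofBitList l) ≤ l.length := by
  induction l with
  | nil => simp [Nat.ofBitList]
  | cons b l ih =>
    have := Nat.size_bit_le b (Nat.ofBitList l)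
    simp [Nat.ofBitList] at *
    omega

@[fun_prop]
theorem PolyTime.nat_ofBitList {l : α → List Bool} (hl : PolyTime l) :
    PolyTime (fun a => Nat.ofBitList (l a)) := by
  have h : PolyTime fun a => (l a).reverse.foldl (fun n b => Nat.bit b n) 0 := by
    obtain ⟨q, hq⟩ := hl.esize_le
    refine hl.list_reverse.list_foldl (.const _) (step := fun _ n b => Nat.bit b n) (by fun_prop)
      (4 * q + 1) fun a m hm => ?_
    have h0 : m.foldl (fun n b => Nat.bit b n) 0 = Nat.ofBitList m.reverse := by
      rw [Nat.ofBitList, List.foldr_reverse]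
    rw [h0]
    have h1 := Nat.size_ofBitList_le m.reverse
    have h2 := esize_nat_le (Nat.ofBitList m.reverse)
    have h3 := hm.length_le
    have h4 := length_lt_esize (l a)
    have h5 := hq a
    simp at *
    omega
  exact h.congr fun a => by
    rw [List.foldl_reverse]; rfl

/-- The `m` least significant bits. -/
def Nat.lowBits : ℕ → ℕ → List Bool
  | 0, _ => []
  | m + 1, k => k.bodd :: Nat.lowBits m k.div2

theorem Nat.ofBitList_lowBits (m k : ℕ) (h : k < 2 ^ m) : Nat.ofBitList (Nat.lowBits m k) = k := by
  induction m generalizing k with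
  | zero => simp at h; simp [h, Nat.ofBitList, Nat.lowBits]
  | succ m ih =>
    have := ih k.div2 (by rw [Nat.div2_val]; rw [pow_succ] at h; omega)
    conv_rhs => rw [← Nat.bit_bodd_div2 k, ← this]
    rfl

/-- One step of the addition of two numbers with carry. -/
def addStep (s : ℕ × ℕ × Bool × List Bool) (_ : Bool) : ℕ × ℕ × Bool × List Bool :=
  (s.1.div2, s.2.1.div2, (s.1.bodd && s.2.1.bodd) || (s.2.2.1 && (s.1.bodd || s.2.1.bodd)),
    (s.1.bodd ^^ s.2.1.bodd ^^ s.2.2.1) :: s.2.2.2)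

/-- The entries of `l` are ignored: the list serves only as a clock that determines how many bits of
the sum are produced. -/
theorem foldl_addStep (l : List Bool) (x y : ℕ) (c : Bool) (acc : List Bool) :
    (l.foldl addStep (x, y, c, acc)).2.2.2 =
      (Nat.lowBits l.length (x + y + c.toNat)).reverse ++ acc := by
  induction l generalizing x y c acc with
  | nil => simp [Nat.lowBits]
  | cons b l ih =>
    have h1 : (x + y + c.toNat).bodd = (x.bodd ^^ y.bodd ^^ c) := by
      cases c <;> simp
    have h2 : (x + y + c.toNat).div2 = x.div2 + y.div2 +
        ((x.bodd && y.bodd) || (c && (x.bodd || y.bodd))).toNat := by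
      have e1 := Nat.bodd_add_div2 x
      have e2 := Nat.bodd_add_div2 y
      rw [Nat.div2_val]
      revert e1 e2
      generalize x.div2 = x'
      generalize y.div2 = y'
      cases x.bodd <;> cases y.bodd <;> cases c <;> simp <;> omega
    rw [List.foldl_cons, addStep, ih]
    simp only [List.length_cons, Nat.lowBits, h1, h2]
    simp

theorem esize_div2_le (k : ℕ) : esize k.div2 ≤ esize k := by
  rw [esize_nat, esize_nat, Nat.div2_bits_eq_tail]
  exact esize_le_of_sublist (List.tail_sublist _)

@[fun_prop]
theorem PolyTime.nat_add {f g : α → ℕ} (hf : PolyTime f) (hg : PolyTime g) :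
    PolyTime (fun a => f a + g a) := by
  -- The clock has one tick more than the two bit lengths together, which is enough for all bits of
  -- the sum.
  have h : PolyTime fun a => ((f a).bits ++ (g a).bits ++ [false]).foldl addStep
      (f a, g a, false, []) := by
    refine PolyTime.list_foldl_of_growth (by fun_prop) (by fun_prop) (step := fun _ => addStep)
      (by unfold addStep; fun_prop) 10 fun a s b => ?_
    obtain ⟨x, y, c, acc⟩ := s
    have h1 := esize_div2_le x
    have h2 := esize_div2_le y
    have h3 := esize_bool_le ((x.bodd && y.bodd) || (c && (x.bodd || y.bodd)))
    have h4 := esize_bool_le (x.bodd ^^ y.bodd ^^ c)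
    simp only [addStep, esize_pair, esize_cons, Polynomial.eval_ofNat]
    omega
  refine h.snd.snd.snd.list_reverse.nat_ofBitList.congr fun a => ?_
  rw [foldl_addStep, List.append_nil, List.reverse_reverse, Nat.ofBitList_lowBits]
  · simp
  · have h1 := Nat.lt_size_self (f a)
    have h2 := Nat.lt_size_self (g a)
    have h3 := Nat.pow_le_pow_right (n := 2) (by omega) (Nat.le_add_right (f a).size (g a).size)
    have h4 := Nat.pow_le_pow_right (n := 2) (by omega) (Nat.le_add_left (g a).size (f a).size)
    simp only [List.length_append, List.length_singleton, Nat.size_eq_bits_len, pow_succ] at *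
    simp
    omega

/-- One step of the comparison of two numbers, from the least significant bit on. -/
def leStep (s : ℕ × ℕ × Bool) (_ : Bool) : ℕ × ℕ × Bool :=
  (s.1.div2, s.2.1.div2, bif s.1.bodd ^^ s.2.1.bodd then s.2.1.bodd else s.2.2)

/-- Bits are read from the least significant one on, so a later difference overrides the earlier
verdict. The initial verdict `c` survives only if all bits agree. -/
theorem foldl_leStep (l : List Bool) (x y : ℕ) (c : Bool) (hx : x < 2 ^ l.length)
    (hy : y < 2 ^ l.length) :
    (l.foldl leStep (x, y, c)).2.2 = bif decide (x = y) then c else decide (x < y) := by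
  induction l generalizing x y c with
  | nil => simp at hx hy; simp [hx, hy]
  | cons b l ih =>
    rw [List.length_cons, pow_succ] at hx hy
    rw [List.foldl_cons, leStep, ih _ _ _ (by simp only [Nat.div2_val]; omega)
      (by simp only [Nat.div2_val]; omega)]
    have e1 := Nat.bodd_add_div2 x
    have e2 := Nat.bodd_add_div2 y
    revert e1 e2
    generalize x.div2 = x'
    generalize y.div2 = y'
    intro e1 e2
    rcases lt_trichotomy x' y' with h | h | h
    · have h1 : x < y := by
        revert e1 e2; cases x.bodd <;> cases y.bodd <;> simp <;> omega
      simp [h, h1, h.ne, h1.ne]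
    · revert e1 e2
      subst h
      cases x.bodd <;> cases y.bodd <;> simp <;> intro e1 e2 <;> subst e1 e2 <;> simp
    · have h1 : y < x := by
        revert e1 e2; cases x.bodd <;> cases y.bodd <;> simp <;> omega
      simp [h.not_gt, h1.not_gt, h.ne', h1.ne']

@[fun_prop]
theorem PolyTime.nat_le {f g : α → ℕ} (hf : PolyTime f) (hg : PolyTime g) :
    PolyTime (fun a => decide (f a ≤ g a)) := by
  have h : PolyTime fun a => ((f a).bits ++ (g a).bits).foldl leStep (f a, g a, true) := by
    refine PolyTime.list_foldl_of_growth (by fun_prop) (by fun_prop) (step := fun _ => leStep)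
      (by unfold leStep; fun_prop) 10 fun a s b => ?_
    obtain ⟨x, y, c⟩ := s
    have h1 := esize_div2_le x
    have h2 := esize_div2_le y
    have h3 := esize_bool_le (bif x.bodd ^^ y.bodd then y.bodd else c)
    simp only [leStep, esize_pair, Polynomial.eval_ofNat]
    omega
  refine h.snd.snd.congr fun a => ?_
  rw [foldl_leStep]
  · rcases lt_trichotomy (f a) (g a) with h | h | h
    · simp [h, h.le, h.ne]
    · simp [h]
    · simp [h.not_ge, h.not_gt, h.ne']
  · rw [List.length_append, Nat.size_eq_bits_len, Nat.size_eq_bits_len]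
    exact (Nat.lt_size_self _).trans_le (Nat.pow_le_pow_right (by omega) (by omega))
  · rw [List.length_append, Nat.size_eq_bits_len, Nat.size_eq_bits_len]
    exact (Nat.lt_size_self _).trans_le (Nat.pow_le_pow_right (by omega) (by omega))

@[fun_prop]
theorem PolyTime.nat_lt {f g : α → ℕ} (hf : PolyTime f) (hg : PolyTime g) :
    PolyTime (fun a => decide (f a < g a)) :=
  (hg.nat_le hf).not.congr fun a => by rw [← decide_not, decide_eq_decide]; exact not_le.symm

@[fun_prop]
theorem PolyTime.nat_eq {f g : α → ℕ} (hf : PolyTime f) (hg : PolyTime g) :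
    PolyTime (fun a => decide (f a = g a)) :=
  ((hf.nat_le hg).and (hg.nat_le hf)).congr fun a => by
    rw [← Bool.decide_and, decide_eq_decide]; exact le_antisymm_iff

@[fun_prop]
theorem PolyTime.nat_mul {f g : α → ℕ} (hf : PolyTime f) (hg : PolyTime g) :
    PolyTime (fun a => f a * g a) := by
  have h : PolyTime fun a => (f a).bits.reverse.foldl
      (fun n b => Nat.bit false n + bif b then g a else 0) 0 := by
    obtain ⟨q1, hq1⟩ := hf.nat_bits.esize_le
    obtain ⟨q2, hq2⟩ := hg.esize_le
    refine PolyTime.list_foldl (by fun_prop) (by fun_prop)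
      (step := fun a n b => Nat.bit false n + bif b then g a else 0)
      ((PolyTime.nat_bit (.const _) (by fun_prop)).nat_add (by fun_prop)) (4 * (q1 + q2) + 1)
      fun a m hm => ?_
    -- Horner's scheme sends `v` to at most `2 * v + g a`. Adding `g a` to both sides turns this
    -- into a plain doubling of `v + g a`, which iterates.
    have key : ∀ (m : List Bool) (v : ℕ),
        m.foldl (fun n b => Nat.bit false n + bif b then g a else 0) v + g a ≤
          2 ^ m.length * (v + g a) := by
      intro m
      induction m with
      | nil => simp
      | cons b m ih =>
        intro v
        refine (ih _).trans ?_
        rw [List.length_cons, pow_succ, mul_assoc]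
        refine Nat.mul_le_mul_left _ ?_
        cases b <;> simp [Nat.bit] <;> omega
    have h1 := key m 0
    rw [zero_add] at h1
    have h2 : Nat.size (m.foldl (fun n b => Nat.bit false n + bif b then g a else 0) 0) ≤
        m.length + Nat.size (g a) := by
      rw [Nat.size_le, pow_add]
      have h3 := Nat.lt_size_self (g a)
      have h4 := Nat.mul_lt_mul_of_pos_left h3 (Nat.pow_pos (n := m.length) (show 0 < 2 by omega))
      omega
    have h3 := esize_nat_le (m.foldl (fun n b => Nat.bit false n + bif b then g a else 0) 0)
    have h4 := hm.length_le
    have h5 := length_lt_esize (f a).bits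
    have h6 := hq1 a
    have h7 := hq2 a
    have h8 := Nat.size_le_esize (g a)
    simp at *
    omega
  refine h.congr fun a => ?_
  conv_lhs => rw [← Nat.ofBitList_bits (f a)]
  rw [List.foldl_reverse]
  induction (f a).bits with
  | nil => simp [Nat.ofBitList]
  | cons b l ih =>
    rw [List.foldr_cons, ← ih]
    cases b <;> simp [Nat.ofBitList, Nat.bit] <;> ring

theorem esize_zipIdx_le (l : List β) (i M : ℕ) (h : i + l.length ≤ M) :
    esize (l.zipIdx i) ≤ esize l + l.length * (4 * M + 2) := by
  induction l generalizing i with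
  | nil => simp
  | cons b l ih =>
    simp only [List.length_cons] at h
    have h1 := ih (i + 1) (by omega)
    have h2 := esize_nat_le i
    have h3 : Nat.size i ≤ i := Nat.size_le.2 Nat.lt_two_pow_self
    simp only [List.zipIdx_cons, esize_cons, esize_pair, List.length_cons]
    have h4 : (l.length + 1) * (4 * M + 2) = l.length * (4 * M + 2) + (4 * M + 2) := by ring
    omega

theorem PolyTime.list_zipIdx_aux {l : α → List β} (hl : PolyTime l) :
    PolyTime fun a => (l a).foldl (fun (s : ℕ × List (β × ℕ)) b =>
      (s.1 + 1, s.2 ++ [(b, s.1)])) (0, []) := by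
  obtain ⟨q, hq⟩ := hl.esize_le
  refine PolyTime.list_foldl (by fun_prop) (by fun_prop)
    (step := fun a s b => (s.1 + 1, s.2 ++ [(b, s.1)])) (by fun_prop)
    (q + q * (4 * q + 2) + 4 * q + 2) fun a m hm => ?_
  rw [List.foldl_zipIdx_state]
  have h1 := esize_zipIdx_le m 0 m.length (by omega)
  have h2 := esize_nat_le m.length
  have h3 : Nat.size m.length ≤ m.length := Nat.size_le.2 Nat.lt_two_pow_self
  have h4 : m.length ≤ q.eval (esize a) := by
    have := hm.length_le
    have := length_lt_esize (l a)
    have := hq a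
    omega
  have h5 : m.length * (4 * m.length + 2) ≤ q.eval (esize a) * (4 * q.eval (esize a) + 2) :=
    Nat.mul_le_mul h4 (by omega)
  have h6 := (esize_le_of_sublist hm.sublist).trans (hq a)
  simp at *
  omega

@[fun_prop]
theorem PolyTime.list_zipIdx {l : α → List β} (hl : PolyTime l) :
    PolyTime (fun a => (l a).zipIdx) :=
  hl.list_zipIdx_aux.snd.congr fun a => by rw [List.foldl_zipIdx_state]; simp

@[fun_prop]
theorem PolyTime.list_length {l : α → List β} (hl : PolyTime l) :
    PolyTime (fun a => (l a).length) :=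
  hl.list_zipIdx_aux.fst.congr fun a => by rw [List.foldl_zipIdx_state]; simp

end Arithmetic

/-! ## The algorithm

A closed walk `x₀, …, x_ℓ` in a tree is described by one word for each vertex `v`: its letter number
`t` is `v` if `x_t = v`, and otherwise the neighbour of `v` in the direction of `x_t`.  Words of
neighbouring vertices have to fit together, and all other conditions on the walk concern the words
of the single vertices. -/

section Algorithm

variable {α β : Type} [Enc α] [Enc β]

/-- The root and the end vertices of all edges. -/
def vertexList (root : ℕ) (E : List (ℕ × ℕ × β)) : List ℕ :=
  root :: E.flatMap fun e => [e.1, e.2.1]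

/-- The neighbours of a vertex, each with the label of the edge that leads to it. -/
def labelledNeighbors (E : List (ℕ × ℕ × β)) (v : ℕ) : List (ℕ × β) :=
  E.flatMap fun e => bif decide (e.1 = v) then [(e.2.1, e.2.2)]
    else bif decide (e.2.1 = v) then [(e.1, e.2.2)] else []

/-- All numbers below `k * vs.length`. -/
def indexList (k : ℕ) (vs : List ℕ) : List ℕ :=
  (vs.flatMap fun _ => List.replicate k 0).zipIdx.map fun p => p.2

/-- All words of length less than `k * vs.length` that repeat one letter from `vs`. -/
def constantWords (k : ℕ) (vs : List ℕ) : List (List ℕ) :=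
  (indexList k vs).flatMap fun i => vs.map fun w =>
    ((indexList k vs).filter fun j => decide (j < i)).map fun _ => w

/-- All concatenations of `m` constant words. -/
def candidateWords (k : ℕ) (vs : List ℕ) : ℕ → List (List ℕ)
  | 0 => [[]]
  | m + 1 => (constantWords k vs).flatMap fun b => (candidateWords k vs m).map fun x => b ++ x

/-- The conditions on the word of the vertex `v` with the neighbours `N`. -/
def wordOK (root : ℕ) (N : List (ℕ × β)) (v : ℕ) (w : List ℕ) : Bool :=
  (w.all fun x => decide (x = v) || N.any fun u => decide (u.1 = x)) &&
  ((w.zip w.tail).all fun p => bif decide (p.1 = v) then !decide (p.2 = v)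
    else decide (p.2 = p.1) || decide (p.2 = v)) &&
  (!decide (v = root) || (decide (w.headD (root + 1) = root) &&
    decide (w.reverse.headD (root + 1) = root)))

/-- The condition that the words `x` and `y` of two neighbouring vertices `u` and `v` fit together:
at each time the walk is on exactly one of the two sides of the edge. -/
def wordsFit (u v : ℕ) (x y : List ℕ) : Bool :=
  decide (x.length = y.length) &&
    (x.zip y).all fun p => decide (p.1 = v) ^^ decide (p.2 = u)

/-- Keep the entries of the table that fit to some entry of each neighbour. -/
def refineTable (E : List (ℕ × ℕ × β)) (t : List (ℕ × List ℕ)) : List (ℕ × List ℕ) :=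
  t.filter fun e => (labelledNeighbors E e.1).all fun u =>
    t.any fun e' => decide (e'.1 = u.1) && wordsFit e.1 u.1 e.2 e'.2

/-- All vertices with candidates for their words. -/
def initialTable (k m root : ℕ) (E : List (ℕ × ℕ × β)) (chk : ℕ → List ℕ → Bool) :
    List (ℕ × List ℕ) :=
  (vertexList root E).flatMap fun v =>
    ((candidateWords k (vertexList root E) m).filter fun w =>
      wordOK root (labelledNeighbors E v) v w && chk v w).map fun w => (v, w)

/-- Search for a family of words that fit together and satisfy the test `chk`. -/
def solve (k m root : ℕ) (E : List (ℕ × ℕ × β)) (chk : ℕ → List ℕ → Bool) : Bool :=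
  ((initialTable k m root E chk).foldl (fun t _ => refineTable E t)
    (initialTable k m root E chk)).any fun e => decide (e.1 = root)

/-! ### Polynomial running time of the search -/

@[fun_prop]
theorem PolyTime.vertexList {root : α → ℕ} {E : α → List (ℕ × ℕ × β)} (hr : PolyTime root)
    (hE : PolyTime E) : PolyTime fun a => vertexList (root a) (E a) := by
  unfold _root_.vertexList; fun_prop

@[fun_prop]
theorem PolyTime.labelledNeighbors {v : α → ℕ} {E : α → List (ℕ × ℕ × β)} (hv : PolyTime v)
    (hE : PolyTime E) : PolyTime fun a => labelledNeighbors (E a) (v a) := by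
  unfold _root_.labelledNeighbors; fun_prop

@[fun_prop]
theorem PolyTime.indexList (k : ℕ) {vs : α → List ℕ} (hv : PolyTime vs) :
    PolyTime fun a => indexList k (vs a) := by
  unfold _root_.indexList; fun_prop

@[fun_prop]
theorem PolyTime.constantWords (k : ℕ) {vs : α → List ℕ} (hv : PolyTime vs) :
    PolyTime fun a => constantWords k (vs a) := by
  unfold _root_.constantWords; fun_prop

-- The recursion depth `m` is a constant of the problem and is unfolded into the program. The degree
-- of the polynomial may grow with `m`.
@[fun_prop]
theorem PolyTime.candidateWords (k : ℕ) {vs : α → List ℕ} (hv : PolyTime vs) (m : ℕ) :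
    PolyTime fun a => candidateWords k (vs a) m := by
  induction m with
  | zero => exact .const _
  | succ m ih =>
    have h : PolyTime fun x : α × List ℕ => _root_.candidateWords k (vs x.1) m :=
      ih.comp PolyTime.id.fst
    exact PolyTime.list_flatMap (hv.constantWords k)
      (g := fun a b => (_root_.candidateWords k (vs a) m).map fun x => b ++ x)
      (PolyTime.list_map h (by fun_prop))

@[fun_prop]
theorem PolyTime.wordOK {root v : α → ℕ} {N : α → List (ℕ × β)} {w : α → List ℕ}
    (hr : PolyTime root) (hN : PolyTime N) (hv : PolyTime v) (hw : PolyTime w) :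
    PolyTime fun a => wordOK (root a) (N a) (v a) (w a) := by
  unfold _root_.wordOK; fun_prop

@[fun_prop]
theorem PolyTime.wordsFit {u v : α → ℕ} {x y : α → List ℕ} (hu : PolyTime u) (hv : PolyTime v)
    (hx : PolyTime x) (hy : PolyTime y) : PolyTime fun a => wordsFit (u a) (v a) (x a) (y a) := by
  unfold _root_.wordsFit; fun_prop

@[fun_prop]
theorem PolyTime.refineTable {E : α → List (ℕ × ℕ × β)} {t : α → List (ℕ × List ℕ)}
    (hE : PolyTime E) (ht : PolyTime t) : PolyTime fun a => refineTable (E a) (t a) := by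
  unfold _root_.refineTable; fun_prop

theorem PolyTime.initialTable (k m : ℕ) {root : α → ℕ} {E : α → List (ℕ × ℕ × β)}
    {chk : α → ℕ → List ℕ → Bool} (hr : PolyTime root) (hE : PolyTime E)
    (hc : PolyTime fun x : α × ℕ × List ℕ => chk x.1 x.2.1 x.2.2) :
    PolyTime fun a => initialTable k m (root a) (E a) (chk a) := by
  have h : PolyTime fun x : (α × ℕ) × List ℕ => chk x.1.1 x.1.2 x.2 :=
    PolyTime.comp hc (f := fun x : (α × ℕ) × List ℕ => (x.1.1, x.1.2, x.2)) (by fun_prop)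
  unfold _root_.initialTable; fun_prop

theorem PolyTime.solve (k m : ℕ) {root : α → ℕ} {E : α → List (ℕ × ℕ × β)}
    {chk : α → ℕ → List ℕ → Bool} (hr : PolyTime root) (hE : PolyTime E)
    (hc : PolyTime fun x : α × ℕ × List ℕ => chk x.1 x.2.1 x.2.2) :
    PolyTime fun a => solve k m (root a) (E a) (chk a) := by
  have h1 := PolyTime.initialTable k m hr hE hc
  have h2 : PolyTime fun a => (_root_.initialTable k m (root a) (E a) (chk a)).foldl
      (fun t _ => _root_.refineTable (E a) t) (_root_.initialTable k m (root a) (E a) (chk a)) :=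
    -- Refinement only deletes entries, so the table never grows and the growth polynomial is zero.
    h1.list_foldl_of_growth h1 (step := fun a t _ => _root_.refineTable (E a) t) (by fun_prop) 0
      fun a s b => by
        simpa using esize_le_of_sublist (l := _root_.refineTable (E a) s) List.filter_sublist
  unfold _root_.solve; fun_prop

/-- The times at which the walk goes from `v` to `u`, read off from the word of `v`. -/
def arcTimes (w : List ℕ) (v u : ℕ) : List ℕ :=
  ((w.zip w.tail).zipIdx.filter fun p => decide (p.1.1 = v) && decide (p.1.2 = u)).map
    fun p => p.2

@[fun_prop]
theorem PolyTime.arcTimes {w : α → List ℕ} {v u : α → ℕ} (hw : PolyTime w) (hv : PolyTime v)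
    (hu : PolyTime u) : PolyTime fun a => arcTimes (w a) (v a) (u a) := by
  unfold _root_.arcTimes; fun_prop

/-- The time of the traversal that follows the traversal number `y`, if the traversals take place
at the times `T` of each round of length `l`. -/
def nextTime (T : List ℕ) (l y : ℕ) : ℕ := T.getD (y + 1) (T.getD 0 0 + l)

@[fun_prop]
theorem PolyTime.nextTime {T : α → List ℕ} {l : α → ℕ} (hT : PolyTime T) (hl : PolyTime l)
    (y : ℕ) : PolyTime fun a => nextTime (T a) (l a) y := by
  unfold _root_.nextTime; fun_prop

/-- The test for the word of `v` in the first problem, with the condition `c` on the numbers of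
traversals. -/
def traversalCheck (F : ℕ) (c : ℕ → ℕ → Bool) (E : List (ℕ × ℕ × (ℕ × List ℕ) × Unit)) (v : ℕ)
    (w : List ℕ) : Bool :=
  (labelledNeighbors E v).all fun u =>
    c (arcTimes w v u.1).length u.2.1.1 && (List.range F).all fun y =>
      !decide (y < (arcTimes w v u.1).length) ||
        decide (nextTime (arcTimes w v u.1) w.tail.length y ≤
          u.2.1.2.getD y 0 + (arcTimes w v u.1).getD y 0)

theorem PolyTime.traversalCheck (F : ℕ) {c : ℕ → ℕ → Bool}
    (hc : PolyTime fun x : ℕ × ℕ => c x.1 x.2) {E : α → List (ℕ × ℕ × (ℕ × List ℕ) × Unit)}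
    {v : α → ℕ} {w : α → List ℕ} (hE : PolyTime E) (hv : PolyTime v) (hw : PolyTime w) :
    PolyTime fun a => traversalCheck F c (E a) (v a) (w a) := by
  have h1 : PolyTime fun x : α × ℕ × (ℕ × List ℕ) × Unit =>
      c (_root_.arcTimes (w x.1) (v x.1) x.2.1).length x.2.2.1.1 :=
    PolyTime.comp hc (f := fun x : α × ℕ × (ℕ × List ℕ) × Unit =>
      ((_root_.arcTimes (w x.1) (v x.1) x.2.1).length, x.2.2.1.1)) (by fun_prop)
  have h2 : PolyTime fun x : α × ℕ × (ℕ × List ℕ) × Unit => (List.range F).all fun y =>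
      !decide (y < (_root_.arcTimes (w x.1) (v x.1) x.2.1).length) ||
        decide (_root_.nextTime (_root_.arcTimes (w x.1) (v x.1) x.2.1) (w x.1).tail.length y ≤
          x.2.2.1.2.getD y 0 + (_root_.arcTimes (w x.1) (v x.1) x.2.1).getD y 0) :=
    PolyTime.forall_lt F fun y => by fun_prop
  unfold _root_.traversalCheck
  exact PolyTime.list_all (by fun_prop) (h1.and h2)

/-- The entry of a list at an index that is part of the data. -/
def entryAt (t : List (List β)) (i : ℕ) : List β :=
  ((t.zipIdx.filter fun p => decide (p.2 = i)).map fun p => p.1).headD []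

@[fun_prop]
theorem PolyTime.entryAt {t : α → List (List β)} {i : α → ℕ} (ht : PolyTime t)
    (hi : PolyTime i) : PolyTime fun a => entryAt (t a) (i a) := by
  unfold _root_.entryAt; fun_prop

/-- The test for the word of `v` in the second problem that concerns single arcs; rational numbers
are given as pairs of numerator and denominator. -/
def priorityCheck (F L : ℕ) (t : List (List (ℕ × ℕ))) (E : List (ℕ × ℕ × (ℕ × ℕ) × Unit))
    (v : ℕ) (w : List ℕ) : Bool :=
  (labelledNeighbors E v).all fun u =>
    (decide (1 ≤ (arcTimes w v u.1).length) && decide ((arcTimes w v u.1).length ≤ u.2.1.1)) &&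
      (List.range F).all fun y => !decide (y < (arcTimes w v u.1).length) ||
        decide (nextTime (arcTimes w v u.1) w.tail.length y *
            ((entryAt t u.2.1.2).getD y (0, 1)).2 ≤
          ((entryAt t u.2.1.2).getD y (0, 1)).1 * L +
            (arcTimes w v u.1).getD y 0 * ((entryAt t u.2.1.2).getD y (0, 1)).2)

theorem PolyTime.priorityCheck (F : ℕ) {L : α → ℕ} {t : α → List (List (ℕ × ℕ))}
    {E : α → List (ℕ × ℕ × (ℕ × ℕ) × Unit)} {v : α → ℕ} {w : α → List ℕ} (hL : PolyTime L)
    (ht : PolyTime t) (hE : PolyTime E) (hv : PolyTime v) (hw : PolyTime w) :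
    PolyTime fun a => priorityCheck F (L a) (t a) (E a) (v a) (w a) := by
  unfold _root_.priorityCheck
  refine PolyTime.list_all (by fun_prop) (.and (by fun_prop) (PolyTime.forall_lt F fun y => ?_))
  fun_prop

/-- The capacity condition, tested on the word of the root. -/
def capacityCheck (L : ℕ) (c : ℕ × ℕ) (v : ℕ) (w : List ℕ) : Bool :=
  w.zipIdx.all fun i => w.zipIdx.all fun j =>
    !(decide (i.2 < j.2) && decide (c.1 * L + c.2 * i.2 < c.2 * j.2)) ||
      w.zipIdx.any fun k => decide (k.1 = v) && (decide (i.2 < k.2) && decide (k.2 < j.2))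

@[fun_prop]
theorem PolyTime.capacityCheck {L v : α → ℕ} {c : α → ℕ × ℕ} {w : α → List ℕ} (hL : PolyTime L)
    (hc : PolyTime c) (hv : PolyTime v) (hw : PolyTime w) :
    PolyTime fun a => capacityCheck (L a) (c a) (v a) (w a) := by
  unfold _root_.capacityCheck; fun_prop

end Algorithm

/-! ## Closed walks in trees and directions toward their positions -/

namespace SimpleGraph

variable {V : Type*} {G : SimpleGraph V}

/-- If `u` lies on `q`, acyclicity makes the first step of `q` go to `u`, and uniqueness of paths
identifies the rest with `p`. If not, putting the edge in front of `q` gives a path, which must be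
`p`. -/
theorem IsTree.eq_cons_or_eq_cons (hG : G.IsTree) {u v x : V} (h : G.Adj u v) {p : G.Walk u x}
    {q : G.Walk v x} (hp : p.IsPath) (hq : q.IsPath) :
    p = .cons h q ∨ q = .cons h.symm p := by
  classical
  by_cases hu : u ∈ q.support
  · right
    have h1 := hG.isAcyclic.eq_snd_of_adj_start hq h.symm hu
    cases q with
    | nil => simp at hu; exact absurd hu h.ne
    | cons h' q' =>
      simp only [Walk.snd_cons] at h1
      subst h1
      congr 1
      exact (hG.existsUnique_path _ _).unique hq.of_cons hp
  · left
    exact (hG.existsUnique_path _ _).unique hp (hq.cons hu)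

/-- The neighbour of `u` on the path from `u` to `x`, and `u` itself if `x = u`. -/
noncomputable def IsTree.toward (hG : G.IsTree) (u x : V) : V :=
  (hG.existsUnique_path u x).choose.snd

theorem IsTree.toward_eq_snd (hG : G.IsTree) {u x : V} {p : G.Walk u x} (hp : p.IsPath) :
    hG.toward u x = p.snd := by
  rw [toward, (hG.existsUnique_path u x).unique (hG.existsUnique_path u x).choose_spec.1 hp]

theorem IsTree.toward_self (hG : G.IsTree) (x : V) : hG.toward x x = x :=
  hG.toward_eq_snd .nil

theorem IsTree.adj_toward (hG : G.IsTree) {u x : V} (h : u ≠ x) : G.Adj u (hG.toward u x) :=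
  Walk.adj_snd (Walk.not_nil_of_ne h)

theorem IsTree.toward_eq_self_iff (hG : G.IsTree) {u x : V} : hG.toward u x = u ↔ u = x := by
  refine ⟨fun h => ?_, fun h => h ▸ hG.toward_self u⟩
  by_contra hne
  exact (hG.adj_toward hne).ne h.symm

/-- Removing the edge leaves `x` on exactly one of its two sides, so exactly one of its ends looks
across it. -/
theorem IsTree.toward_eq_iff_of_adj (hG : G.IsTree) {u v : V} (h : G.Adj u v) (x : V) :
    hG.toward u x = v ↔ hG.toward v x ≠ u := by
  obtain ⟨p, hp, -⟩ := hG.existsUnique_path u x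
  obtain ⟨q, hq, -⟩ := hG.existsUnique_path v x
  rw [hG.toward_eq_snd hp, hG.toward_eq_snd hq]
  rcases hG.eq_cons_or_eq_cons h hp hq with rfl | rfl
  · simp only [Walk.snd_cons, true_iff]
    rintro rfl
    exact ((Walk.cons_isPath_iff _ _).1 hp).2 (q.getVert_mem_support 1)
  · simp only [Walk.snd_cons, ne_eq, not_true_eq_false, iff_false]
    rintro rfl
    exact ((Walk.cons_isPath_iff _ _).1 hq).2 (p.getVert_mem_support 1)

theorem IsTree.toward_of_adj (hG : G.IsTree) {u v : V} (h : G.Adj u v) : hG.toward u v = v := by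
  rw [hG.toward_eq_iff_of_adj h, hG.toward_self]
  exact h.ne'

theorem Walk.snd_append_of_ne {u x y : V} (p : G.Walk u x) (q : G.Walk x y) (h : u ≠ x) :
    (p.append q).snd = p.snd := by
  cases p with
  | nil => exact absurd rfl h
  | cons _ p => simp

/-- The paths from `u` to `x` and to `y` differ only by an edge at the far end. So a moving object
cannot change its branch at `u` without visiting `u`. -/
theorem IsTree.toward_eq_toward (hG : G.IsTree) {u x y : V} (h : G.Adj x y) (hx : u ≠ x)
    (hy : u ≠ y) : hG.toward u x = hG.toward u y := by
  obtain ⟨p, hp, -⟩ := hG.existsUnique_path x u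
  obtain ⟨q, hq, -⟩ := hG.existsUnique_path y u
  rw [hG.toward_eq_snd hp.reverse, hG.toward_eq_snd hq.reverse]
  rcases hG.eq_cons_or_eq_cons h hp hq with rfl | rfl
  · rw [Walk.reverse_cons, Walk.snd_append_of_ne _ _ hy]
  · rw [Walk.reverse_cons, Walk.snd_append_of_ne _ _ hx]

/-- Induction along the path to `x`: the next vertex already points onward and not back to `v`, so
consistency on the edge forces `v` to point to it. -/
theorem IsTree.eq_toward (hG : G.IsTree) {D : V → V} {x : V} (hx : D x = x)
    (h : ∀ u v, G.Adj u v → (D u = v ↔ D v ≠ u)) (v : V) : D v = hG.toward v x := by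
  obtain ⟨p, hp, -⟩ := hG.existsUnique_path v x
  rw [hG.toward_eq_snd hp]
  induction p with
  | nil => exact hx
  | cons hadj p ih =>
    rw [Walk.snd_cons, h _ _ hadj, ih hx hp.of_cons]
    intro h1
    refine ((Walk.cons_isPath_iff _ _).1 hp).2 ?_
    rw [← h1]
    exact p.getVert_mem_support 1

/-- Directions that are consistent along all edges and change as if they point toward a moving
object belong to a walk. -/
theorem IsTree.exists_walk_of_directions (hG : G.IsTree) {D : V → ℕ → V} {r : V} (l : ℕ)
    (h1 : ∀ v, ∀ t ≤ l, D v t = v ∨ G.Adj v (D v t))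
    (h2 : ∀ v, ∀ t < l, D v t = v → D v (t + 1) ≠ v)
    (h3 : ∀ v, ∀ t < l, D v t ≠ v → D v (t + 1) = D v t ∨ D v (t + 1) = v)
    (h4 : ∀ u v, ∀ t ≤ l, G.Adj u v → (D u t = v ↔ D v t ≠ u))
    (h5 : D r 0 = r) :
    ∃ (x : V) (w : G.Walk r x), w.length = l ∧
      ∀ v, ∀ t ≤ l, D v t = hG.toward v (w.getVert t) := by
  induction l with
  | zero =>
    refine ⟨r, .nil, rfl, fun v t ht => ?_⟩
    obtain rfl : t = 0 := by omega
    exact hG.eq_toward h5 (fun u v huv => h4 u v 0 le_rfl huv) v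
  | succ l ih =>
    obtain ⟨x, w, hw, hD⟩ := ih (fun v t ht => h1 v t (by omega)) (fun v t ht => h2 v t (by omega))
      (fun v t ht => h3 v t (by omega)) (fun u v t ht => h4 u v t (by omega))
    have hDl : ∀ v, D v l = hG.toward v x := fun v => by
      rw [hD v l le_rfl, ← hw, Walk.getVert_length]
    have hne : D x (l + 1) ≠ x := h2 x l (by omega) (by rw [hDl, hG.toward_self])
    have hadj : G.Adj x (D x (l + 1)) := (h1 x (l + 1) le_rfl).resolve_left hne
    generalize hy : D x (l + 1) = y at *
    -- The new position is the vertex `y` to which the old position `x` now points. Before the step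
    -- `y` pointed to `x`; now `x` points to `y`, so `y` cannot keep its direction and must point to
    -- itself.
    have hyy : D y (l + 1) = y := by
      have e1 : D y l = x := by rw [hDl, hG.toward_of_adj hadj.symm]
      have e2 : D y (l + 1) ≠ x := (h4 x y (l + 1) le_rfl hadj).1 hy
      rcases h3 y l (by omega) (by rw [e1]; exact hadj.ne) with h | h
      · exact absurd (h.trans e1) e2
      · exact h
    refine ⟨y, w.concat hadj, by simp [hw], fun v t ht => ?_⟩
    rw [Walk.concat_eq_append, Walk.getVert_append]
    rcases Nat.lt_or_ge l t with hlt | hle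
    · obtain rfl : t = l + 1 := by omega
      rw [if_neg (by omega), hw, Nat.add_sub_cancel_left]
      exact hG.eq_toward hyy (fun u v huv => h4 u v _ le_rfl huv) v
    · rw [hD v t hle]
      rcases hle.lt_or_eq with hlt | rfl
      · rw [if_pos (by omega)]
      · rw [if_neg (by omega), hw, Nat.sub_self, Walk.getVert_zero, ← hw, Walk.getVert_length]

/-- A choice of values along a walk to the vertex `r`, starting from a value at `r`. -/
noncomputable def Walk.extend {A : Type*} {P : V → A → Prop} {B : V → V → A → A → Prop} {r : V}
    (h : ∀ v a, P v a → ∀ u, G.Adj v u → ∃ b, P u b ∧ B v u a b) (a : {a // P r a}) :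
    {v : V} → G.Walk v r → {a // P v a}
  | _, .nil => a
  | _, .cons (v := v) hadj p =>
    ⟨_, (h v (p.extend h a).1 (p.extend h a).2 _ hadj.symm).choose_spec.1⟩
termination_by structural _ w => w

theorem Walk.extend_cons {A : Type*} {P : V → A → Prop} {B : V → V → A → A → Prop} {r u v : V}
    (h : ∀ v a, P v a → ∀ u, G.Adj v u → ∃ b, P u b ∧ B v u a b) (a : {a // P r a})
    (hadj : G.Adj u v) (p : G.Walk v r) :
    B v u (p.extend h a).1 ((Walk.cons hadj p).extend h a).1 :=
  (h v (p.extend h a).1 (p.extend h a).2 _ hadj.symm).choose_spec.2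

/-- In a tree, arc consistency of binary constraints yields a solution. -/
theorem IsTree.exists_solution (hG : G.IsTree) {A : Type*} {P : V → A → Prop}
    {B : V → V → A → A → Prop} (hB : ∀ u v a b, B u v a b → B v u b a)
    (h : ∀ v a, P v a → ∀ u, G.Adj v u → ∃ b, P u b ∧ B v u a b) {r : V} {a : A} (ha : P r a) :
    ∃ f : V → A, (∀ v, P v (f v)) ∧ ∀ u v, G.Adj u v → B u v (f u) (f v) := by
  choose p hp _ using fun v => hG.existsUnique_path v r
  refine ⟨fun v => ((p v).extend h ⟨a, ha⟩).1, fun v => ((p v).extend h ⟨a, ha⟩).2,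
    fun u v huv => ?_⟩
  -- Values are propagated outward from `r` along the unique paths. For adjacent vertices one path
  -- extends the other by their edge, so one value was chosen as a partner of the other.
  rcases hG.eq_cons_or_eq_cons huv (hp u) (hp v) with h1 | h1
  · simp only [h1]
    exact hB _ _ _ _ (Walk.extend_cons h ⟨a, ha⟩ huv (p v))
  · simp only [h1]
    exact Walk.extend_cons h ⟨a, ha⟩ huv.symm (p u)

end SimpleGraph

/-! ## Properties of the list functions of the algorithm -/

theorem List.mem_zip_tail_iff {A : Type*} {l : List A} {x y : A} :
    (x, y) ∈ l.zip l.tail ↔ ∃ t, l[t]? = some x ∧ l[t + 1]? = some y := by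
  simp only [List.mem_iff_getElem?, List.getElem?_zip_eq_some, List.getElem?_tail]

theorem List.map_snd_filter_zipIdx {A : Type*} (f : A → Bool) (l : List A) :
    (l.zipIdx.filter fun p => f p.1).map (fun p => p.2) =
      (List.range l.length).filter fun i => l[i]?.any f := by
  induction l using List.reverseRecOn with
  | nil => rfl
  | append_singleton l a ih =>
    rw [List.zipIdx_append, List.filter_append, List.map_append, ih, List.length_append,
      List.length_singleton, List.range_succ, List.filter_append]
    congr 1
    · refine List.filter_congr fun i hi => ?_
      rw [List.getElem?_append_left (List.mem_range.1 hi)]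
    · cases h : f a <;> simp [h]

theorem List.map_snd_zipIdx {A : Type*} (l : List A) :
    l.zipIdx.map (fun p => p.2) = List.range l.length := by
  have := List.map_snd_filter_zipIdx (fun _ => true) l
  rw [List.filter_true] at this
  rw [this, List.filter_eq_self]
  intro i hi
  simp [List.mem_range.1 hi]

theorem List.filter_lt_range {i k : ℕ} (h : i ≤ k) :
    (List.range k).filter (fun j => decide (j < i)) = List.range i := by
  obtain ⟨d, rfl⟩ := Nat.exists_eq_add_of_le h
  rw [List.range_add, List.filter_append, List.filter_eq_self.2 (by simp),
    List.filter_eq_nil_iff.2 (by simp), List.append_nil]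

theorem indexList_eq (k : ℕ) (vs : List ℕ) : indexList k vs = List.range (vs.length * k) := by
  rw [indexList, List.map_snd_zipIdx]
  simp [List.length_flatMap]

theorem replicate_mem_constantWords {k a x : ℕ} {vs : List ℕ} (hx : x ∈ vs)
    (ha : a < vs.length * k) : List.replicate a x ∈ constantWords k vs := by
  simp only [constantWords, List.mem_flatMap, List.mem_map, indexList_eq, List.mem_range]
  refine ⟨a, ha, x, hx, ?_⟩
  rw [List.filter_lt_range ha.le]
  simp

/-- Before the first `v` the letter cannot change. The alternative `x = v` supplies a dummy letter
when the initial block is empty. -/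
theorem List.exists_eq_replicate_append {v : ℕ} (w : List ℕ)
    (h : w.IsChain fun x y => x ≠ v → y = x ∨ y = v) :
    ∃ a x r, w = List.replicate a x ++ r ∧ (x = v ∨ x ∈ w) ∧ (r = [] ∨ ∃ r', r = v :: r') := by
  induction w with
  | nil => exact ⟨0, v, [], by simp⟩
  | cons y w ih =>
    by_cases hy : y = v
    · exact ⟨0, v, y :: w, by simp [hy]⟩
    · obtain ⟨a, x, r, h1, h2, h3⟩ := ih h.tail
      cases w with
      | nil => exact ⟨1, y, [], by simp⟩
      | cons z w =>
        rcases (List.isChain_cons_cons.1 h).1 hy with rfl | rfl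
        · cases a with
          | zero =>
            rcases h3 with rfl | ⟨r', rfl⟩
            · simp at h1
            · simp at h1
              exact absurd h1.1 hy
          | succ a =>
            simp only [List.replicate_succ, List.cons_append, List.cons.injEq] at h1
            obtain ⟨rfl, h1⟩ := h1
            exact ⟨a + 2, z, r, by simp [List.replicate_succ, h1], by simp, h3⟩
        · exact ⟨1, y, z :: w, by simp⟩

theorem append_mem_candidateWords {k m : ℕ} {vs b w : List ℕ} (hb : b ∈ constantWords k vs)
    (hw : w ∈ candidateWords k vs m) : b ++ w ∈ candidateWords k vs (m + 1) := by
  simp only [candidateWords, List.mem_flatMap, List.mem_map]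
  exact ⟨b, hb, w, hw, rfl⟩

/-- A word in which only the letter `v` interrupts the repetition of letters, and which has few
letters `v`, is one of the candidates. -/
theorem mem_candidateWords {k v : ℕ} {vs : List ℕ} (hv : v ∈ vs) (hk : 1 < vs.length * k) (c : ℕ)
    (w : List ℕ) (hw : ∀ x ∈ w, x ∈ vs) (hch : w.IsChain fun x y => x ≠ v → y = x ∨ y = v)
    (hlen : w.length < vs.length * k) (hc : w.count v ≤ c) :
    w ∈ candidateWords k vs (2 * c + 1) := by
  have hnil : ([] : List ℕ) ∈ constantWords k vs :=
    replicate_mem_constantWords (a := 0) hv (by omega)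
  have hone : [v] ∈ constantWords k vs := replicate_mem_constantWords (a := 1) hv hk
  induction c generalizing w with
  | zero =>
    obtain ⟨a, x, r, rfl, h2, h3⟩ := List.exists_eq_replicate_append w hch
    have hx : x ∈ vs := h2.elim (fun h => h ▸ hv) (hw x)
    rcases h3 with rfl | ⟨r', rfl⟩
    · refine append_mem_candidateWords (replicate_mem_constantWords hx ?_) (by simp [candidateWords])
      simpa using hlen
    · simp at hc
  | succ c ih =>
    obtain ⟨a, x, r, rfl, h2, h3⟩ := List.exists_eq_replicate_append w hch
    have hx : x ∈ vs := h2.elim (fun h => h ▸ hv) (hw x)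
    have ha : List.replicate a x ∈ constantWords k vs :=
      replicate_mem_constantWords hx (by simp at hlen; omega)
    rcases h3 with rfl | ⟨r', rfl⟩
    -- No letter `v` is left, and the unused blocks are filled with empty words. In the other case
    -- below, an occurrence of `v` consumes two blocks, the run before it and `[v]`; with the final
    -- run this gives `2 * c + 1`.
    · refine append_mem_candidateWords ha ?_
      exact append_mem_candidateWords hnil (ih [] (by simp) (by simp)
        (by rw [List.length_nil]; omega) (by simp))
    · refine append_mem_candidateWords ha ?_
      refine append_mem_candidateWords hone (ih r' (fun y hy => hw y (by simp [hy]))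
        hch.right_of_append.tail (by simp at hlen; omega) ?_)
      simp at hc
      omega

theorem wordsFit_iff {u v : ℕ} {x y : List ℕ} : wordsFit u v x y = true ↔
    x.length = y.length ∧ ∀ t < x.length, x[t]? = some v ↔ y[t]? ≠ some u := by
  rw [wordsFit, Bool.and_eq_true, decide_eq_true_iff]
  refine and_congr_right fun hl => ?_
  rw [List.all_eq_true]
  constructor
  · intro h t ht
    have h1 := h (x[t], y[t]) (List.mem_iff_getElem.2 ⟨t, by simp [← hl, ht], by simp⟩)
    rw [List.getElem?_eq_getElem ht, List.getElem?_eq_getElem (hl ▸ ht)]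
    by_cases h2 : x[t] = v <;> simp [h2] at h1 ⊢ <;> exact h1
  · intro h p hp
    obtain ⟨t, ht, rfl⟩ := List.mem_iff_getElem.1 hp
    have ht' : t < x.length := by simp [hl] at ht; omega
    have h1 := h t ht'
    rw [List.getElem?_eq_getElem ht', List.getElem?_eq_getElem (hl ▸ ht')] at h1
    simp only [List.getElem_zip]
    by_cases h2 : x[t] = v <;> simp [h2] at h1 ⊢ <;> exact h1

theorem wordsFit_symm {u v : ℕ} {x y : List ℕ} (h : wordsFit u v x y = true) :
    wordsFit v u y x = true := by
  rw [wordsFit_iff] at *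
  refine ⟨h.1.symm, fun t ht => ?_⟩
  have := h.2 t (h.1 ▸ ht)
  tauto

/-- The default `r + 1` differs from `r`, so the test rejects the empty word. -/
theorem List.headD_succ_eq_iff {l : List ℕ} {r : ℕ} : l.headD (r + 1) = r ↔ l.head? = some r := by
  cases l <;> simp

theorem wordOK_iff {β : Type} {r v : ℕ} {N : List (ℕ × β)} {w : List ℕ} :
    wordOK r N v w = true ↔ (∀ x ∈ w, x = v ∨ ∃ b, (x, b) ∈ N) ∧
      (∀ t x y, w[t]? = some x → w[t + 1]? = some y →
        (x = v → y ≠ v) ∧ (x ≠ v → y = x ∨ y = v)) ∧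
      (v = r → w.head? = some r ∧ w.getLast? = some r) := by
  rw [wordOK, Bool.and_eq_true, Bool.and_eq_true, and_assoc]
  refine and_congr ?_ (and_congr ?_ ?_)
  · simp only [List.all_eq_true, Bool.or_eq_true, decide_eq_true_iff, List.any_eq_true,
      Prod.exists, exists_and_right, exists_eq_right]
  · rw [List.all_eq_true]
    constructor
    · intro h t x y hx hy
      have := h (x, y) (List.mem_zip_tail_iff.2 ⟨t, hx, hy⟩)
      by_cases h1 : x = v <;> simp_all
    · rintro h ⟨x, y⟩ hp
      obtain ⟨t, hx, hy⟩ := List.mem_zip_tail_iff.1 hp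
      have := h t x y hx hy
      by_cases h1 : x = v <;> simp_all
  · simp only [Bool.or_eq_true, Bool.not_eq_true', decide_eq_false_iff_not, Bool.and_eq_true,
      decide_eq_true_iff, List.headD_succ_eq_iff, List.head?_reverse]
    tauto

theorem List.foldl_const_eq_iterate {A B : Type*} (f : A → A) (l : List B) (a : A) :
    l.foldl (fun t _ => f t) a = f^[l.length] a := by
  induction l generalizing a with
  | nil => rfl
  | cons b l ih => simp [ih]

/-- Every application that changes the list shortens it, so there are at most as many changes as
entries. -/
theorem List.iterate_length_isFixedPt {A : Type*} {f : List A → List A}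
    (hf : ∀ l, (f l).Sublist l) (l : List A) :
    f (f^[l.length] l) = f^[l.length] l := by
  have key : ∀ k, f (f^[k] l) = f^[k] l ∨ (f^[k] l).length + k ≤ l.length := by
    intro k
    induction k with
    | zero => simp
    | succ k ih =>
      rw [Function.iterate_succ_apply']
      by_cases h : f (f^[k] l) = f^[k] l
      · exact .inl (by rw [h, h])
      · have h1 := ih.resolve_left h
        have h2 : (f (f^[k] l)).length < (f^[k] l).length :=
          lt_of_le_of_ne (hf _).length_le fun e => h ((hf _).eq_of_length e)
        exact .inr (by omega)
  rcases key l.length with h | h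
  · exact h
  · have h1 : f^[l.length] l = [] := List.eq_nil_of_length_eq_zero (by omega)
    rw [h1]
    exact List.eq_nil_of_sublist_nil (hf [])

/-! ## Edge lists of graphs -/

section EdgeLists

variable {n : ℕ} {β : Type}

open Classical in
/-- The list of all edges of a graph with their labels. -/
noncomputable def edgeList (G : SimpleGraph (Fin n)) (lab : G.edgeSet → β) : List (ℕ × ℕ × β) :=
  (List.finRange n).flatMap fun u => (List.finRange n).filterMap fun v =>
    if h : u < v ∧ G.Adj u v then some (u.val, v.val, lab ⟨s(u, v), h.2⟩) else none

theorem mem_edgeList {G : SimpleGraph (Fin n)} {lab : G.edgeSet → β} {e : ℕ × ℕ × β} :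
    e ∈ edgeList G lab ↔ ∃ (u v : Fin n) (h : G.Adj u v), u < v ∧
      e = (u.val, v.val, lab ⟨s(u, v), h⟩) := by
  simp only [edgeList, List.mem_flatMap, List.mem_filterMap, List.mem_finRange, true_and]
  constructor
  · rintro ⟨u, v, h⟩
    split_ifs at h with h1
    exact ⟨u, v, h1.2, h1.1, (Option.some.inj h).symm⟩
  · rintro ⟨u, v, h, h1, rfl⟩
    exact ⟨u, v, by rw [dif_pos ⟨h1, h⟩]⟩

/-- A list of three items is a nested pair ending in `nil`. The unit component attached to the label
accounts for this end marker. -/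
theorem encodeEdges_eq [Enc β] (G : SimpleGraph (Fin n)) (lab : G.edgeSet → β) :
    encodeEdges G (fun e => enc (lab e)) = enc (edgeList G fun e => (lab e, ())) := by
  change SExp.ofList _ = SExp.ofList (List.map enc _)
  rw [edgeList, List.map_flatMap]
  congr 2
  funext u
  rw [List.map_filterMap]
  congr 1
  funext v
  split_ifs <;> rfl

theorem mem_labelledNeighbors {E : List (ℕ × ℕ × β)} {v u : ℕ} {b : β} :
    (u, b) ∈ labelledNeighbors E v ↔ (v, u, b) ∈ E ∨ (u ≠ v ∧ (u, v, b) ∈ E) ∨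
      (u = v ∧ (v, v, b) ∈ E) := by
  simp only [labelledNeighbors, List.mem_flatMap]
  constructor
  · rintro ⟨⟨x, y, c⟩, h1, h2⟩
    by_cases hx : x = v
    · simp [hx] at h2
      obtain ⟨rfl, rfl⟩ := h2
      exact .inl (hx ▸ h1)
    · by_cases hy : y = v
      · simp [hx, hy] at h2
        obtain ⟨rfl, rfl⟩ := h2
        exact .inr (.inl ⟨hx, hy ▸ h1⟩)
      · simp [hx, hy] at h2
  · rintro (h | ⟨h1, h⟩ | ⟨rfl, h⟩)
    · exact ⟨_, h, by simp⟩
    · exact ⟨_, h, by simp [h1]⟩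
    · exact ⟨_, h, by simp⟩

theorem mem_labelledNeighbors_edgeList {G : SimpleGraph (Fin n)} {lab : G.edgeSet → β} {v : Fin n}
    {u : ℕ} {b : β} : (u, b) ∈ labelledNeighbors (edgeList G lab) v ↔
      ∃ (x : Fin n) (h : G.Adj v x), u = x ∧ b = lab ⟨s(v, x), h⟩ := by
  rw [mem_labelledNeighbors]
  simp only [mem_edgeList, Prod.mk.injEq]
  constructor
  · rintro (⟨x, y, h, h1, h2, h3, h4⟩ | ⟨-, x, y, h, h1, h2, h3, h4⟩ | ⟨-, x, y, h, h1, h2, h3, h4⟩)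
    · obtain rfl : v = x := Fin.ext h2
      exact ⟨y, h, h3, h4⟩
    · obtain rfl : v = y := Fin.ext h3
      exact ⟨x, h.symm, h2, by rw [h4]; congr 2; exact Sym2.eq_swap⟩
    · obtain rfl : v = y := Fin.ext h3
      exact absurd (Fin.ext h2) h.ne'
  · rintro ⟨x, h, rfl, rfl⟩
    rcases lt_or_gt_of_ne h.ne with h1 | h1
    · exact .inl ⟨v, x, h, h1, rfl, rfl, rfl⟩
    · refine .inr (.inl ⟨fun e => h.ne' (Fin.ext e), x, v, h.symm, h1, rfl, rfl, ?_⟩)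
      congr 2; exact Sym2.eq_swap

theorem mem_vertexList_edgeList {G : SimpleGraph (Fin n)} (hG : G.Connected)
    {lab : G.edgeSet → β} {r : Fin n} {x : ℕ} : x ∈ vertexList r (edgeList G lab) ↔ x < n := by
  simp only [vertexList, List.mem_cons, List.mem_flatMap, List.not_mem_nil, or_false]
  constructor
  · rintro (rfl | ⟨e, h1, h2⟩)
    · exact r.2
    · obtain ⟨u, v, h, -, rfl⟩ := mem_edgeList.1 h1
      rcases h2 with rfl | rfl
      · exact u.2
      · exact v.2
  · intro hx
    by_cases hr : (⟨x, hx⟩ : Fin n) = r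
    · exact .inl (by rw [← hr])
    · obtain ⟨w⟩ := hG.preconnected ⟨x, hx⟩ r
      have hadj := w.adj_snd (SimpleGraph.Walk.not_nil_of_ne hr)
      obtain ⟨b, h⟩ : ∃ b, (w.snd.val, b) ∈ labelledNeighbors (edgeList G lab) x :=
        ⟨_, mem_labelledNeighbors_edgeList.2 ⟨_, hadj, rfl, rfl⟩⟩
      rcases mem_labelledNeighbors.1 h with h | ⟨-, h⟩ | ⟨-, h⟩
      · exact .inr ⟨_, h, .inl rfl⟩
      · exact .inr ⟨_, h, .inr rfl⟩
      · exact .inr ⟨_, h, .inr rfl⟩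

/-- The list contains repetitions, but a lower bound is enough to make the candidate words long
enough. -/
theorem le_length_vertexList {G : SimpleGraph (Fin n)} (hG : G.Connected)
    {lab : G.edgeSet → β} {r : Fin n} : n ≤ (vertexList r (edgeList G lab)).length := by
  have h : List.range n ⊆ vertexList r (edgeList G lab) := fun x hx =>
    (mem_vertexList_edgeList hG).2 (List.mem_range.1 hx)
  simpa using (List.nodup_range.subperm h).length_le

end EdgeLists

/-! ## The words of a closed walk -/

namespace SimpleGraph

variable {n : ℕ} {G : SimpleGraph (Fin n)}

/-- The word of the vertex `v` for the walk `w`. -/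
noncomputable def IsTree.wordOf (hG : G.IsTree) {r x : Fin n} (w : G.Walk r x) (v : Fin n) :
    List ℕ :=
  (List.range (w.length + 1)).map fun t => (hG.toward v (w.getVert t)).val

@[simp]
theorem IsTree.length_wordOf (hG : G.IsTree) {r x : Fin n} (w : G.Walk r x) (v : Fin n) :
    (hG.wordOf w v).length = w.length + 1 := by simp [wordOf]

theorem IsTree.getElem?_wordOf (hG : G.IsTree) {r x : Fin n} (w : G.Walk r x) (v : Fin n) {t : ℕ}
    (ht : t ≤ w.length) : (hG.wordOf w v)[t]? = some (hG.toward v (w.getVert t)).val := by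
  simp [wordOf, Nat.lt_succ_of_le ht]

theorem IsTree.le_of_getElem?_wordOf (hG : G.IsTree) {r x : Fin n} {w : G.Walk r x} {v : Fin n}
    {t y : ℕ} (h : (hG.wordOf w v)[t]? = some y) : t ≤ w.length := by
  have := (List.getElem?_eq_some_iff.1 h).1
  rw [length_wordOf] at this
  omega

theorem IsTree.toward_getVert_succ (hG : G.IsTree) {r x : Fin n} (w : G.Walk r x) (v : Fin n)
    {t : ℕ} (ht : t < w.length) :
    (hG.toward v (w.getVert t) = v → hG.toward v (w.getVert (t + 1)) ≠ v) ∧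
      (hG.toward v (w.getVert t) ≠ v →
        hG.toward v (w.getVert (t + 1)) = hG.toward v (w.getVert t) ∨
          hG.toward v (w.getVert (t + 1)) = v) := by
  have hadj := w.adj_getVert_succ ht
  simp only [ne_eq, hG.toward_eq_self_iff]
  constructor
  · intro h1 h2
    exact hadj.ne (h1.symm.trans h2)
  · intro h1
    by_cases h2 : v = w.getVert (t + 1)
    · exact .inr h2
    · exact .inl (hG.toward_eq_toward hadj h1 h2).symm

variable {β : Type}

/-- The families of words that fit together are exactly the words of closed walks. -/
theorem IsTree.exists_walk_iff (hG : G.IsTree) (lab : G.edgeSet → β) (r : Fin n)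
    (f : Fin n → List ℕ) :
    ((∀ v : Fin n, wordOK r (labelledNeighbors (edgeList G lab) v) v (f v) = true) ∧
      ∀ u v : Fin n, G.Adj u v → wordsFit u v (f u) (f v) = true) ↔
    ∃ w : G.Walk r r, ∀ v, f v = hG.wordOf w v := by
  simp only [wordOK_iff, wordsFit_iff]
  constructor
  · rintro ⟨h1, h2⟩
    obtain ⟨hr, hlast⟩ := (h1 r).2.2 rfl
    obtain ⟨l, hl⟩ : ∃ l, (f r).length = l + 1 :=
      Nat.exists_eq_succ_of_ne_zero (by rintro h; simp at h; simp [h] at hr)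
    -- Neighbouring words have equal length, so connectedness gives a common length.
    have hlen : ∀ v, (f v).length = l + 1 := by
      intro v
      obtain ⟨w⟩ := hG.connected.preconnected v r
      induction w with
      | nil => exact hl
      | cons h p ih => exact (h2 _ _ h).1.trans (ih h1 hr hlast hl)
    have hD : ∀ v : Fin n, ∀ t, ∃ x : Fin n, t ≤ l →
        (f v)[t]? = some x.val ∧ (x = v ∨ G.Adj v x) := by
      intro v t
      by_cases ht : t ≤ l
      · have ht' : t < (f v).length := by rw [hlen]; omega
        rcases (h1 v).1 _ (List.getElem_mem ht') with h3 | ⟨b, h3⟩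
        · exact ⟨v, fun _ => ⟨by rw [List.getElem?_eq_getElem ht', h3], .inl rfl⟩⟩
        · obtain ⟨x, hx, h4, -⟩ := mem_labelledNeighbors_edgeList.1 h3
          exact ⟨x, fun _ => ⟨by rw [List.getElem?_eq_getElem ht', h4], .inr hx⟩⟩
      · exact ⟨v, fun h => absurd h ht⟩
    choose D hD using hD
    obtain ⟨x, w, hw, hwD⟩ := hG.exists_walk_of_directions (D := D) (r := r) l
      (fun v t ht => (hD v t ht).2)
      (fun v t ht h e => ((h1 v).2.1 t _ _ (hD v t ht.le).1 (hD v (t + 1) ht).1).1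
        (by rw [h]) (by rw [e]))
      (fun v t ht h => (((h1 v).2.1 t _ _ (hD v t ht.le).1 (hD v (t + 1) ht).1).2
        fun e => h (Fin.ext e)).imp Fin.ext Fin.ext)
      (fun u v t ht huv => by
        have h3 := (h2 u v huv).2 t (by rw [hlen]; omega)
        rw [(hD u t ht).1, (hD v t ht).1] at h3
        simpa [Fin.ext_iff] using h3)
      (by
        have h3 := (hD r 0 (by omega)).1
        rw [← List.head?_eq_getElem?, hr] at h3
        exact (Fin.ext (Option.some.inj h3)).symm)
    obtain rfl : x = r := by
      have h3 := (hD r l le_rfl).1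
      rw [List.getLast?_eq_getElem?, hlen, Nat.add_sub_cancel, h3] at hlast
      have h4 := hwD r l le_rfl
      rw [← hw, Walk.getVert_length, hw, Fin.ext (Option.some.inj hlast)] at h4
      exact (hG.toward_eq_self_iff.1 h4.symm).symm
    refine ⟨w, fun v => List.ext_getElem? fun t => ?_⟩
    by_cases ht : t ≤ l
    · rw [(hD v t ht).1, hG.getElem?_wordOf w v (hw ▸ ht), hwD v t ht]
    · rw [List.getElem?_eq_none (by rw [hlen]; omega),
        List.getElem?_eq_none (by rw [hG.length_wordOf, hw]; omega)]
  · rintro ⟨w, hw⟩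
    simp only [hw]
    refine ⟨fun v => ⟨fun x hx => ?_, fun t x y hx hy => ?_, fun hv => ?_⟩, fun u v huv => ⟨?_, ?_⟩⟩
    · obtain ⟨t, -, rfl⟩ := List.mem_map.1 hx
      by_cases h : v = w.getVert t
      · exact .inl (by rw [← h, hG.toward_self])
      · exact .inr ⟨_, mem_labelledNeighbors_edgeList.2 ⟨_, hG.adj_toward h, rfl, rfl⟩⟩
    · have ht := hG.le_of_getElem?_wordOf hy
      rw [hG.getElem?_wordOf w v (by omega)] at hx
      rw [hG.getElem?_wordOf w v ht] at hy
      obtain rfl := Option.some.inj hx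
      obtain rfl := Option.some.inj hy
      simpa [Fin.ext_iff] using hG.toward_getVert_succ w v ht
    · obtain rfl := Fin.ext hv
      rw [List.head?_eq_getElem?, List.getLast?_eq_getElem?, hG.length_wordOf,
        hG.getElem?_wordOf w v (by omega), hG.getElem?_wordOf w v (by omega)]
      simp [hG.toward_self]
    · simp
    · intro t ht
      rw [hG.length_wordOf] at ht
      rw [hG.getElem?_wordOf w u (by omega), hG.getElem?_wordOf w v (by omega)]
      simpa [Fin.ext_iff] using hG.toward_eq_iff_of_adj huv (w.getVert t)

end SimpleGraph

/-! ## Correctness of the algorithm -/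

section Correctness

variable {n : ℕ} {G : SimpleGraph (Fin n)} {β : Type}

theorem mem_initialTable {k m r : ℕ} {E : List (ℕ × ℕ × β)} {chk : ℕ → List ℕ → Bool} {v : ℕ}
    {w : List ℕ} : (v, w) ∈ initialTable k m r E chk ↔ v ∈ vertexList r E ∧
      w ∈ candidateWords k (vertexList r E) m ∧ wordOK r (labelledNeighbors E v) v w = true ∧
      chk v w = true := by
  simp only [initialTable, List.mem_flatMap, List.mem_map, List.mem_filter, Bool.and_eq_true,
    Prod.mk.injEq]
  constructor
  · rintro ⟨x, hx, y, hy, rfl, rfl⟩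
    exact ⟨hx, hy.1, hy.2.1, hy.2.2⟩
  · rintro ⟨h1, h2, h3, h4⟩
    exact ⟨v, h1, w, ⟨h2, h3, h4⟩, rfl, rfl⟩

theorem mem_refineTable {E : List (ℕ × ℕ × β)} {t : List (ℕ × List ℕ)} {v : ℕ} {w : List ℕ} :
    (v, w) ∈ refineTable E t ↔ (v, w) ∈ t ∧ ∀ u b, (u, b) ∈ labelledNeighbors E v →
      ∃ x, (u, x) ∈ t ∧ wordsFit v u w x = true := by
  simp only [refineTable, List.mem_filter, List.all_eq_true, List.any_eq_true, Bool.and_eq_true,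
    decide_eq_true_iff, Prod.forall]
  refine and_congr_right fun _ => forall₃_congr fun u b _ => ?_
  constructor
  · rintro ⟨⟨_, x⟩, h1, rfl, h2⟩
    exact ⟨x, h1, h2⟩
  · rintro ⟨x, h1, h2⟩
    exact ⟨(u, x), h1, rfl, h2⟩

/-- The final table is a fixed point of refinement, hence arc consistent, and a surviving entry at
the root extends to a solution of the tree constraints. Conversely, the words of a solution support
each other and are never deleted. -/
theorem solve_iff_exists_words (hG : G.IsTree) (lab : G.edgeSet → β) (r : Fin n) (k m : ℕ)
    (chk : ℕ → List ℕ → Bool) :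
    solve k m r (edgeList G lab) chk = true ↔ ∃ f : Fin n → List ℕ,
      ((∀ v : Fin n, wordOK r (labelledNeighbors (edgeList G lab) v) v (f v) = true) ∧
        ∀ u v : Fin n, G.Adj u v → wordsFit u v (f u) (f v) = true) ∧
      ∀ v : Fin n, f v ∈ candidateWords k (vertexList r (edgeList G lab)) m ∧
        chk v (f v) = true := by
  have hsub : ∀ t : List (ℕ × List ℕ), (refineTable (edgeList G lab) t).Sublist t :=
    fun t => List.filter_sublist
  rw [solve, List.foldl_const_eq_iterate]
  generalize hT : initialTable k m r (edgeList G lab) chk = T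
  have hfix := List.iterate_length_isFixedPt hsub T
  simp only [List.any_eq_true, decide_eq_true_iff, Prod.exists]
  constructor
  · rintro ⟨_, a, ha, rfl⟩
    have hsubT : ∀ i, ((refineTable (edgeList G lab))^[i] T).Sublist T := by
      intro i
      induction i with
      | zero => exact .refl _
      | succ i ih =>
        rw [Function.iterate_succ_apply']
        exact (hsub _).trans ih
    generalize hT' : (refineTable (edgeList G lab))^[T.length] T = T' at *
    have hT'T : T'.Sublist T := hT' ▸ hsubT T.length
    obtain ⟨f, h1, h2⟩ := hG.exists_solution (P := fun (v : Fin n) w => (v.val, w) ∈ T')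
      (B := fun u v x y => wordsFit u v x y = true) (fun _ _ _ _ => wordsFit_symm)
      (fun v w hw u huv => by
        rw [← hfix, mem_refineTable] at hw
        exact hw.2 u _ (mem_labelledNeighbors_edgeList.2 ⟨u, huv, rfl, rfl⟩)) ha
    have h3 : ∀ v, _ := fun v => mem_initialTable.1 (hT ▸ hT'T.subset (h1 v))
    exact ⟨f, ⟨fun v => (h3 v).2.2.1, h2⟩, fun v => ⟨(h3 v).2.1, (h3 v).2.2.2⟩⟩
  · rintro ⟨f, ⟨h1, h2⟩, h3⟩
    suffices h : ∀ i, ∀ v : Fin n, (v.val, f v) ∈ (refineTable (edgeList G lab))^[i] T from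
      ⟨r, f r, h _ r, rfl⟩
    intro i
    induction i with
    | zero =>
      intro v
      rw [← hT]
      exact mem_initialTable.2
        ⟨(mem_vertexList_edgeList hG.connected).2 v.2, (h3 v).1, h1 v, (h3 v).2⟩
    | succ i ih =>
      intro v
      rw [Function.iterate_succ_apply', mem_refineTable]
      refine ⟨ih v, fun u b hu => ?_⟩
      obtain ⟨x, hx, rfl, -⟩ := mem_labelledNeighbors_edgeList.1 hu
      exact ⟨f x, ih x, h2 v x hx⟩

theorem solve_iff_exists_walk (hG : G.IsTree) (lab : G.edgeSet → β) (r : Fin n) (k m : ℕ)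
    (chk : ℕ → List ℕ → Bool) :
    solve k m r (edgeList G lab) chk = true ↔ ∃ w : G.Walk r r, ∀ v : Fin n,
      hG.wordOf w v ∈ candidateWords k (vertexList r (edgeList G lab)) m ∧
        chk v (hG.wordOf w v) = true := by
  rw [solve_iff_exists_words hG]
  constructor
  · rintro ⟨f, h1, h2⟩
    obtain ⟨w, hw⟩ := (hG.exists_walk_iff lab r f).1 h1
    exact ⟨w, fun v => hw v ▸ h2 v⟩
  · rintro ⟨w, hw⟩
    exact ⟨hG.wordOf w, (hG.exists_walk_iff lab r _).2 ⟨w, fun _ => rfl⟩, hw⟩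

/-! ### Traversal times from words, and bounds on visits and lengths -/

theorem traversalTimes_eq {u v : Fin n} (w : G.Walk u v) (a : G.Dart) :
    traversalTimes w a = (List.range w.length).filter fun i =>
      decide (w.getVert i = a.fst ∧ w.getVert (i + 1) = a.snd) := by
  refine List.filter_congr fun i hi => ?_
  have h : i < w.darts.length := by simpa using hi
  rw [decide_eq_decide, List.getElem?_eq_getElem h, Option.some.injEq,
    SimpleGraph.Walk.darts_getElem_eq_getVert, SimpleGraph.Dart.ext_iff, Prod.ext_iff]

theorem traversalCount_eq {u v : Fin n} (w : G.Walk u v) (a : G.Dart) :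
    traversalCount w a = ((Finset.range w.length).filter fun i =>
      w.getVert i = a.fst ∧ w.getVert (i + 1) = a.snd).card := by
  rw [traversalCount, traversalTimes_eq]
  rfl

/-- The letter `a.fst` means that the walk is at `a.fst`. One step later it is at a neighbour, which
is then the next letter. -/
theorem arcTimes_wordOf (hG : G.IsTree) {r : Fin n} (w : G.Walk r r) (a : G.Dart) :
    arcTimes (hG.wordOf w a.fst) a.fst a.snd = traversalTimes w a := by
  rw [arcTimes, List.map_snd_filter_zipIdx fun p : ℕ × ℕ =>
      decide (p.1 = a.fst.val) && decide (p.2 = a.snd.val),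
    traversalTimes_eq, List.length_zip, List.length_tail, hG.length_wordOf, Nat.add_sub_cancel,
    min_eq_right (Nat.le_succ _)]
  refine List.filter_congr fun i hi => ?_
  have hi : i < w.length := List.mem_range.1 hi
  have h1 : ((hG.wordOf w a.fst).zip (hG.wordOf w a.fst).tail)[i]? =
      some ((hG.toward a.fst (w.getVert i)).val, (hG.toward a.fst (w.getVert (i + 1))).val) := by
    rw [List.getElem?_zip_eq_some, List.getElem?_tail]
    exact ⟨hG.getElem?_wordOf w _ hi.le, hG.getElem?_wordOf w _ hi⟩
  rw [h1, Option.any_some, ← Bool.decide_and, decide_eq_decide, Fin.val_inj, Fin.val_inj,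
    hG.toward_eq_self_iff]
  constructor
  · rintro ⟨h2, h3⟩
    refine ⟨h2.symm, ?_⟩
    rw [← h3, h2, hG.toward_of_adj (w.adj_getVert_succ hi)]
  · rintro ⟨h2, h3⟩
    exact ⟨h2.symm, by rw [h3, hG.toward_of_adj a.adj]⟩

/-- Each visit before the end is followed by a step along one of at most `Δ` outgoing arcs, and each
of them is used at most `F` times. -/
theorem card_visits_le {F Δ : ℕ} (hdeg : ∀ v, (G.neighborSet v).ncard ≤ Δ) {r : Fin n}
    (w : G.Walk r r) (hF : ∀ a : G.Dart, traversalCount w a ≤ F) (v : Fin n) :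
    ((Finset.range w.length).filter fun t => w.getVert t = v).card ≤ F * Δ := by
  classical
  refine (Finset.card_le_mul_card_image_of_maps_to (f := fun t => w.getVert (t + 1))
    (t := G.neighborFinset v) ?_ F ?_).trans (Nat.mul_le_mul_left F ?_)
  · intro t ht
    simp only [Finset.mem_filter, Finset.mem_range] at ht
    rw [SimpleGraph.mem_neighborFinset, ← ht.2]
    exact w.adj_getVert_succ ht.1
  · intro u hu
    rw [SimpleGraph.mem_neighborFinset] at hu
    have := hF ⟨(v, u), hu⟩
    rwa [traversalCount_eq, ← Finset.filter_filter] at this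
  · have := hdeg v
    rwa [Set.ncard_eq_toFinset_card'] at this

theorem length_le_of_traversalCount_le {F Δ : ℕ} (hdeg : ∀ v, (G.neighborSet v).ncard ≤ Δ)
    {r : Fin n} (w : G.Walk r r) (hF : ∀ a : G.Dart, traversalCount w a ≤ F) :
    w.length ≤ F * Δ * n := by
  have := Finset.card_le_mul_card_image_of_maps_to (s := Finset.range w.length)
    (f := fun t => w.getVert t) (t := Finset.univ) (fun _ _ => Finset.mem_univ _) (F * Δ)
    fun v _ => card_visits_le hdeg w hF v
  simpa using this

theorem count_wordOf_le {F Δ : ℕ} (hG : G.IsTree) (hdeg : ∀ v, (G.neighborSet v).ncard ≤ Δ)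
    {r : Fin n} (w : G.Walk r r) (hF : ∀ a : G.Dart, traversalCount w a ≤ F) (v : Fin n) :
    (hG.wordOf w v).count v.val ≤ F * Δ + 1 := by
  have h1 : (hG.wordOf w v).count v.val =
      ((Finset.range (w.length + 1)).filter fun t => w.getVert t = v).card := by
    rw [SimpleGraph.IsTree.wordOf, List.count_eq_countP, List.countP_map,
      List.countP_eq_length_filter]
    refine congrArg List.length (List.filter_congr fun t _ => ?_)
    rw [Bool.eq_iff_iff]
    simp only [Function.comp_apply, decide_eq_true_iff, beq_iff_eq, Fin.val_inj,
      hG.toward_eq_self_iff]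
    exact eq_comm
  rw [h1, Finset.range_add_one, Finset.filter_insert]
  refine le_trans ?_ (Nat.add_le_add_right (card_visits_le hdeg w hF v) 1)
  split_ifs
  · exact Finset.card_insert_le _ _
  · omega

/-- The word has length at most `F * Δ * n + 1`, which is less than `n * (F * Δ + 2)`, and it
contains `v` at most `F * Δ + 1` times; these two bounds explain the parameters. -/
theorem wordOf_mem_candidateWords {F Δ : ℕ} (hG : G.IsTree)
    (hdeg : ∀ v, (G.neighborSet v).ncard ≤ Δ) {lab : G.edgeSet → β} {r : Fin n} (w : G.Walk r r)
    (hF : ∀ a : G.Dart, traversalCount w a ≤ F) (v : Fin n) :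
    hG.wordOf w v ∈ candidateWords (F * Δ + 2) (vertexList r (edgeList G lab))
      (2 * (F * Δ + 1) + 1) := by
  have h1 := le_length_vertexList hG.connected (lab := lab) (r := r)
  have h2 : n * (F * Δ + 2) ≤ (vertexList r (edgeList G lab)).length * (F * Δ + 2) :=
    Nat.mul_le_mul_right _ h1
  have h3 := v.pos
  refine mem_candidateWords ((mem_vertexList_edgeList hG.connected).2 v.2) ?_ (F * Δ + 1)
    _ ?_ ?_ ?_ (count_wordOf_le hG hdeg w hF v)
  · have h4 : n * 2 ≤ n * (F * Δ + 2) := Nat.mul_le_mul_left n (by omega)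
    omega
  · intro x hx
    obtain ⟨t, -, rfl⟩ := List.mem_map.1 hx
    exact (mem_vertexList_edgeList hG.connected).2 (Fin.is_lt _)
  · rw [List.isChain_iff_getElem]
    intro t ht
    rw [hG.length_wordOf] at ht
    have h4 := List.getElem?_eq_some_iff.1 (hG.getElem?_wordOf w v (t := t) (by omega))
    have h5 := List.getElem?_eq_some_iff.1 (hG.getElem?_wordOf w v (t := t + 1) (by omega))
    obtain ⟨_, h4⟩ := h4
    obtain ⟨_, h5⟩ := h5
    rw [h4, h5]
    simpa [Fin.ext_iff] using (hG.toward_getVert_succ w v (t := t) (by omega)).2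
  · have := length_le_of_traversalCount_le hdeg w hF
    rw [hG.length_wordOf]
    nlinarith

/-- The algorithm is correct if the test for the words expresses the condition on the walk. -/
theorem solve_iff {F Δ : ℕ} (hG : G.IsTree) (hdeg : ∀ v, (G.neighborSet v).ncard ≤ Δ)
    (lab : G.edgeSet → β) (r : Fin n) (chk : ℕ → List ℕ → Bool) (Q : G.Walk r r → Prop)
    (hQ : ∀ w, (∀ v : Fin n, chk v (hG.wordOf w v) = true) ↔ Q w)
    (hF : ∀ w, Q w → ∀ a : G.Dart, traversalCount w a ≤ F) :
    solve (F * Δ + 2) (2 * (F * Δ + 1) + 1) r (edgeList G lab) chk = true ↔ ∃ w, Q w := by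
  rw [solve_iff_exists_walk hG]
  refine exists_congr fun w => ⟨fun h => (hQ w).1 fun v => (h v).2, fun h v => ⟨?_, (hQ w).2 h v⟩⟩
  exact wordOf_mem_candidateWords hG hdeg w (hF w h) v

/-- Conditions on all neighbours of all vertices are conditions on all arcs. -/
theorem forall_labelledNeighbors_iff (hG : G.IsTree) {lab : G.edgeSet → β} {r : Fin n}
    (w : G.Walk r r) (p : List ℕ → β → Prop) :
    (∀ v : Fin n, ∀ u ∈ labelledNeighbors (edgeList G lab) v,
      p (arcTimes (hG.wordOf w v) v u.1) u.2) ↔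
    ∀ a : G.Dart, p (traversalTimes w a) (lab (arcEdge a)) := by
  constructor
  · intro h a
    have := h a.fst (a.snd, lab (arcEdge a))
      (mem_labelledNeighbors_edgeList.2 ⟨a.snd, a.adj, rfl, rfl⟩)
    rwa [arcTimes_wordOf] at this
  · rintro h v ⟨u, b⟩ hu
    obtain ⟨x, hx, rfl, rfl⟩ := mem_labelledNeighbors_edgeList.1 hu
    have := h ⟨(v, x), hx⟩
    rw [← arcTimes_wordOf hG] at this
    exact this

end Correctness

/-! ## The decision problems -/

/-- Programs see only the encoding, so an instance may be replaced by raw data with the same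
encoding, free of proofs and dependent types. -/
theorem DecidableInPolyTime.of_polyTime {α R : Type} [Enc R] {encode : α → SExp} {P : α → Prop}
    (raw : α → R) (hraw : ∀ I, enc (raw I) = encode I) {f : R → Bool} (hf : PolyTime f)
    (h : ∀ I, f (raw I) = true ↔ P I) : DecidableInPolyTime encode P := by
  obtain ⟨p, q, hp⟩ := hf
  refine ⟨p, q, fun I => ?_⟩
  obtain ⟨s, h1, h2⟩ := hp (raw I)
  rw [hraw] at h1
  refine ⟨f (raw I), s, h1, ?_, h I⟩
  rw [← hraw]
  exact h2

/-- The data of an instance of the first problem. -/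
abbrev RawTraversalInstance := ℕ × ℕ × List (ℕ × ℕ × (ℕ × List ℕ) × Unit) × Unit

namespace TraversalInstance

variable {F Δ : ℕ}

/-- The data of an instance. -/
noncomputable def raw (I : TraversalInstance F Δ) : RawTraversalInstance :=
  (I.n, I.root.val, edgeList I.T fun e => ((I.f e, List.ofFn (I.g e)), ()), ())

theorem enc_raw (I : TraversalInstance F Δ) : enc I.raw = I.encode := by
  have h : ∀ e, enc (I.f e, List.ofFn (I.g e)) =
      SExp.node (SExp.ofNat (I.f e)) (SExp.ofList (List.ofFn fun y => SExp.ofNat (I.g e y))) := by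
    intro e
    change SExp.node _ (SExp.ofList ((List.ofFn (I.g e)).map SExp.ofNat)) = _
    rw [List.map_ofFn]
    rfl
  rw [encode]
  simp only [← h]
  rw [encodeEdges_eq]
  rfl

theorem forall_traversalCheck_iff (I : TraversalInstance F Δ) (c : ℕ → ℕ → Bool)
    (w : I.T.Walk I.root I.root) :
    (∀ v : Fin I.n, traversalCheck F c (edgeList I.T fun e => ((I.f e, List.ofFn (I.g e)), ())) v
      (I.isTree.wordOf w v) = true) ↔
    (∀ a : I.T.Dart, c (traversalCount w a) (I.f (arcEdge a)) = true) ∧ I.RespectsGaps w := by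
  have h := forall_labelledNeighbors_iff I.isTree
    (lab := fun e => ((I.f e, List.ofFn (I.g e)), ())) w fun T b =>
      c T.length b.1.1 = true ∧ ∀ y < F, y < T.length →
        nextTime T w.length y ≤ b.1.2.getD y 0 + T.getD y 0
  have h1 : ∀ v : Fin I.n, (I.isTree.wordOf w v).tail.length = w.length := by simp
  simp only [traversalCheck, List.all_eq_true, Bool.and_eq_true, List.mem_range, Bool.or_eq_true,
    Bool.not_eq_true', decide_eq_false_iff_not, decide_eq_true_iff, h1, ← imp_iff_not_or]
  rw [h, forall_and]
  refine and_congr_right fun _ => forall_congr' fun a => ?_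
  rw [Fin.forall_iff]
  refine forall₂_congr fun y hy => imp_congr_right fun _ => ?_
  -- The gap is a difference of times; the test avoids subtraction by adding the earlier time to the
  -- bound.
  rw [traversalGap, Nat.sub_le_iff_le_add, nextTime]
  simp [List.getD_eq_getElem?_getD, hy]

/-- The three variants of the first problem differ only in `c`. Through `hle`, each bounds the
traversal numbers by `f`, hence by `F`, so the candidate words suffice. -/
theorem decidableInPolyTime (c : ℕ → ℕ → Bool) (hc : PolyTime fun x : ℕ × ℕ => c x.1 x.2)
    (hle : ∀ x y, c x y = true → x ≤ y) :
    DecidableInPolyTime (encode (F := F) (Δ := Δ)) fun I => ∃ w : I.T.Walk I.root I.root,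
      (∀ a : I.T.Dart, c (traversalCount w a) (I.f (arcEdge a)) = true) ∧ I.RespectsGaps w := by
  refine .of_polyTime raw enc_raw (f := fun R : RawTraversalInstance =>
    solve (F * Δ + 2) (2 * (F * Δ + 1) + 1) R.2.1 R.2.2.1 (traversalCheck F c R.2.2.1))
    (PolyTime.solve _ _ (by fun_prop) (by fun_prop)
      (PolyTime.traversalCheck F hc (by fun_prop) (by fun_prop) (by fun_prop))) fun I => ?_
  have h := solve_iff I.isTree I.degree_le (fun e => ((I.f e, List.ofFn (I.g e)), ())) I.root
    (traversalCheck F c (edgeList I.T fun e => ((I.f e, List.ofFn (I.g e)), ())))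
    (fun w => (∀ a : I.T.Dart, c (traversalCount w a) (I.f (arcEdge a)) = true) ∧ I.RespectsGaps w)
    (I.forall_traversalCheck_iff c) fun w hw a => (hle _ _ (hw.1 a)).trans (I.f_le _)
  rw [← h]
  rfl

end TraversalInstance

/-- Cross-multiplication reduces rational comparisons to the natural number arithmetic available to
programs. -/
theorem NNRat.natCast_le_mul_natCast_iff (k L : ℕ) (q : ℚ≥0) :
    (k : ℚ≥0) ≤ q * L ↔ k * q.den ≤ q.num * L := by
  conv_lhs => rw [← NNRat.num_div_den q, div_mul_eq_mul_div,
    le_div_iff₀ (by exact_mod_cast q.den_pos)]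
  exact_mod_cast Iff.rfl

theorem NNRat.mul_natCast_lt_natCast_iff (k L : ℕ) (q : ℚ≥0) :
    q * L < (k : ℚ≥0) ↔ q.num * L < k * q.den := by
  rw [← not_le, NNRat.natCast_le_mul_natCast_iff, not_le]

theorem capacityCheck_iff {n : ℕ} {G : SimpleGraph (Fin n)} (hG : G.IsTree) {r : Fin n}
    (w : G.Walk r r) (L : ℕ) (c : ℚ≥0) :
    capacityCheck L (c.num, c.den) r (hG.wordOf w r) = true ↔
      ∀ i j : ℕ, i < j → j ≤ w.length → c * L < ((j - i : ℕ) : ℚ≥0) →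
        ∃ k, i < k ∧ k < j ∧ w.getVert k = r := by
  have h1 : ∀ p : ℕ → ℕ → Prop, (∀ x i, (x, i) ∈ (hG.wordOf w r).zipIdx → p x i) ↔
      ∀ i ≤ w.length, p (hG.toward r (w.getVert i)).val i := by
    intro p
    simp only [List.mem_zipIdx_iff_getElem?]
    constructor
    · exact fun h i hi => h _ _ (hG.getElem?_wordOf w r hi)
    · intro h x i hx
      have hi := hG.le_of_getElem?_wordOf hx
      rw [hG.getElem?_wordOf w r hi] at hx
      exact Option.some.inj hx ▸ h i hi
  have h2 : ∀ p : ℕ → Prop, (∃ x i, (x, i) ∈ (hG.wordOf w r).zipIdx ∧ x = r.val ∧ p i) ↔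
      ∃ i ≤ w.length, w.getVert i = r ∧ p i := by
    intro p
    have := not_congr (h1 fun x i => ¬ (x = r.val ∧ p i))
    simpa only [not_forall, not_not, Fin.val_inj, hG.toward_eq_self_iff, exists_prop,
      @eq_comm _ r] using this
  simp only [capacityCheck, List.all_eq_true, List.any_eq_true, Bool.or_eq_true,
    Bool.not_eq_true', Bool.and_eq_false_iff, Bool.and_eq_true, decide_eq_true_iff,
    decide_eq_false_iff_not, Prod.forall, Prod.exists]
  simp only [h2]
  rw [h1 fun _ i => ∀ x j, (x, j) ∈ (hG.wordOf w r).zipIdx → _]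
  simp only [h1 fun _ j => (¬ (_ < j) ∨ ¬ (_ < _)) ∨ _]
  simp only [NNRat.mul_natCast_lt_natCast_iff]
  constructor
  · intro h i j hij hj hc
    rcases h i (by omega) j hj with (h3 | h3) | ⟨k, -, h3, h4, h5⟩
    · exact absurd hij h3
    · refine absurd ?_ h3
      rw [Nat.sub_mul] at hc
      have := Nat.mul_le_mul_right c.den hij.le
      rw [mul_comm c.den, mul_comm c.den]
      omega
    · exact ⟨k, h4, h5, h3⟩
  · intro h i hi j hj
    by_cases hij : i < j
    · by_cases hc : c.num * L + c.den * i < c.den * j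
      · obtain ⟨k, h3, h4, h5⟩ := h i j hij hj (by
          rw [Nat.sub_mul, mul_comm j, mul_comm i]
          omega)
        exact .inr ⟨k, by omega, h5, h3, h4⟩
      · exact .inl (.inr hc)
    · exact .inl (.inl hij)

theorem entryAt_ofFn {β : Type} {z : ℕ} (t : Fin z → List β) (k : Fin z) :
    entryAt (List.ofFn t) k = t k := by
  rw [entryAt]
  have h : ∀ b, b ∈ ((List.ofFn t).zipIdx.filter fun p => decide (p.2 = k.val)).map (fun p => p.1) ↔
      b = t k := by
    intro b
    simp [List.mem_zipIdx_iff_getElem?, eq_comm]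
  cases hl : ((List.ofFn t).zipIdx.filter fun p => decide (p.2 = k.val)).map (fun p => p.1) with
  | nil => simpa [hl] using (h (t k)).2 rfl
  | cons b l => exact (h b).1 (by simp [hl])

/-- The data of an instance of the second problem. -/
abbrev RawPlanInstance := ℕ × ℕ × ℕ × ℕ × (ℕ × ℕ) × List (List (ℕ × ℕ)) ×
  List (ℕ × ℕ × (ℕ × ℕ) × Unit) × Unit

namespace PlanInstance

variable {F Δ : ℕ}

/-- The limits as pairs of numerator and denominator. -/
def rawLimits (I : PlanInstance F Δ) : List (List (ℕ × ℕ)) :=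
  List.ofFn fun k => List.ofFn fun i => ((I.t k i).num, (I.t k i).den)

/-- The list of edges. -/
noncomputable def rawEdges (I : PlanInstance F Δ) : List (ℕ × ℕ × (ℕ × ℕ) × Unit) :=
  edgeList I.T fun e => ((I.f e, (I.p e).val), ())

/-- The data of an instance. -/
noncomputable def raw (I : PlanInstance F Δ) : RawPlanInstance :=
  (I.n, I.root.val, I.z, I.L, (I.c.num, I.c.den), I.rawLimits, I.rawEdges, ())

theorem enc_raw (I : PlanInstance F Δ) : enc I.raw = I.encode := by
  have h1 : ∀ e, SExp.node (SExp.ofNat (I.f e)) (SExp.ofNat (I.p e)) =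
      enc (I.f e, (I.p e).val) := fun _ => rfl
  have h2 : enc I.rawLimits = SExp.ofList (List.ofFn fun k =>
      SExp.ofList (List.ofFn fun i => SExp.ofNNRat (I.t k i))) := by
    change SExp.ofList ((List.ofFn _).map enc) = _
    rw [List.map_ofFn]
    congr 2
    funext k
    change SExp.ofList ((List.ofFn _).map enc) = _
    rw [List.map_ofFn]
    rfl
  rw [encode, ← h2]
  simp only [h1]
  rw [encodeEdges_eq]
  rfl

/-- The test for the words of the second problem. -/
def check (F : ℕ) (R : RawPlanInstance) (v : ℕ) (w : List ℕ) : Bool :=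
  priorityCheck F R.2.2.2.1 R.2.2.2.2.2.1 R.2.2.2.2.2.2.1 v w &&
    (decide (w.tail.length ≤ R.2.2.2.1) &&
      (!decide (v = R.2.1) || capacityCheck R.2.2.2.1 R.2.2.2.2.1 v w))

theorem forall_priorityCheck_iff (I : PlanInstance F Δ) (w : I.T.Walk I.root I.root) :
    (∀ v : Fin I.n, priorityCheck F I.L I.rawLimits I.rawEdges v (I.isTree.wordOf w v) = true) ↔
    ∀ a : I.T.Dart, (1 ≤ traversalCount w a ∧ traversalCount w a ≤ I.f (arcEdge a)) ∧
      ∀ i : Fin F, (i : ℕ) < traversalCount w a →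
        (traversalGap w a i : ℚ≥0) ≤ I.t (I.p (arcEdge a)) i * I.L := by
  have h := forall_labelledNeighbors_iff I.isTree
    (lab := fun e => ((I.f e, (I.p e).val), ())) w fun T b =>
      (1 ≤ T.length ∧ T.length ≤ b.1.1) ∧ ∀ y < F, y < T.length →
        nextTime T w.length y * ((entryAt I.rawLimits b.1.2).getD y (0, 1)).2 ≤
          ((entryAt I.rawLimits b.1.2).getD y (0, 1)).1 * I.L +
            T.getD y 0 * ((entryAt I.rawLimits b.1.2).getD y (0, 1)).2
  have h1 : ∀ v : Fin I.n, (I.isTree.wordOf w v).tail.length = w.length := by simp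
  simp only [priorityCheck, List.all_eq_true, Bool.and_eq_true, List.mem_range, Bool.or_eq_true,
    Bool.not_eq_true', decide_eq_false_iff_not, decide_eq_true_iff, h1, ← imp_iff_not_or]
  rw [rawEdges, h]
  refine forall_congr' fun a => and_congr_right fun _ => ?_
  rw [Fin.forall_iff]
  refine forall₂_congr fun y hy => imp_congr_right fun _ => ?_
  have h2 : (entryAt I.rawLimits (I.p (arcEdge a))).getD y (0, 1) =
      ((I.t (I.p (arcEdge a)) ⟨y, hy⟩).num, (I.t (I.p (arcEdge a)) ⟨y, hy⟩).den) := by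
    rw [rawLimits, entryAt_ofFn, List.getD_eq_getElem?_getD, List.getElem?_ofFn, dif_pos hy]
    rfl
  rw [h2, NNRat.natCast_le_mul_natCast_iff, traversalGap, Nat.sub_mul, Nat.sub_le_iff_le_add,
    nextTime]

theorem forall_check_iff (I : PlanInstance F Δ) (w : I.T.Walk I.root I.root) :
    (∀ v : Fin I.n, check F I.raw v (I.isTree.wordOf w v) = true) ↔ I.IsVehicleRoute w := by
  have h1 : ∀ v : Fin I.n, (I.isTree.wordOf w v).tail.length = w.length := by simp
  have h2 := I.forall_priorityCheck_iff w
  have h3 := capacityCheck_iff I.isTree w I.L I.c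
  simp only [check, raw, Bool.and_eq_true, decide_eq_true_iff, h1, forall_and, h2]
  constructor
  · rintro ⟨⟨h4, h5⟩, h6, h7⟩
    -- The length test is the same at every vertex, since all words have the same length; the root
    -- is one vertex at which to read it off.
    refine ⟨h4.1, h4.2, h6 I.root, h5, h3.1 ?_⟩
    simpa using h7 I.root
  · intro h
    refine ⟨⟨⟨h.covers, h.frequency⟩, h.priority⟩, fun _ => h.length_le, fun v => ?_⟩
    by_cases hv : v = I.root
    · subst hv
      simpa using h3.2 h.capacity
    · simp [Fin.val_inj, hv]

theorem decidableInPolyTime :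
    DecidableInPolyTime (encode (F := F) (Δ := Δ)) fun I =>
      ∃ w : I.T.Walk I.root I.root, I.IsVehicleRoute w := by
  refine .of_polyTime raw enc_raw (f := fun R : RawPlanInstance =>
    solve (F * Δ + 2) (2 * (F * Δ + 1) + 1) R.2.1 R.2.2.2.2.2.2.1 (check F R))
    (PolyTime.solve _ _ (by fun_prop) (by fun_prop) ?_) fun I => ?_
  · unfold check
    exact (PolyTime.priorityCheck F (by fun_prop) (by fun_prop) (by fun_prop) (by fun_prop)
      (by fun_prop)).and (by fun_prop)
  · have h := solve_iff I.isTree I.degree_le (fun e => ((I.f e, (I.p e).val), ())) I.root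
      (check F I.raw) I.IsVehicleRoute I.forall_check_iff
      fun w hw a => (hw.frequency a).trans (I.f_le _)
    rw [← h]
    rfl

end PlanInstance

theorem theorem3 (F Δ : ℕ) :
    -- every arc is traversed exactly `f e` times
    DecidableInPolyTime (TraversalInstance.encode (F := F) (Δ := Δ))
      (fun I => ∃ w : I.T.Walk I.root I.root,
        (∀ a : I.T.Dart, traversalCount w a = I.f (arcEdge a)) ∧ I.RespectsGaps w) ∧
    -- every arc is traversed at most `f e` times
    DecidableInPolyTime (TraversalInstance.encode (F := F) (Δ := Δ))
      (fun I => ∃ w : I.T.Walk I.root I.root,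
        (∀ a : I.T.Dart, traversalCount w a ≤ I.f (arcEdge a)) ∧ I.RespectsGaps w) ∧
    -- every arc is traversed at least once and at most `f e` times
    DecidableInPolyTime (TraversalInstance.encode (F := F) (Δ := Δ))
      (fun I => ∃ w : I.T.Walk I.root I.root,
        (∀ a : I.T.Dart, 1 ≤ traversalCount w a ∧ traversalCount w a ≤ I.f (arcEdge a)) ∧
          I.RespectsGaps w) ∧
    -- existence of vehicle routes
    DecidableInPolyTime (PlanInstance.encode (F := F) (Δ := Δ))
      (fun I => ∃ w : I.T.Walk I.root I.root, I.IsVehicleRoute w) := by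
  refine ⟨?_, ?_, ?_, PlanInstance.decidableInPolyTime⟩
  · simpa using TraversalInstance.decidableInPolyTime (F := F) (Δ := Δ)
      (fun x y => decide (x = y)) (by fun_prop) (by simp +contextual)
  · simpa using TraversalInstance.decidableInPolyTime (F := F) (Δ := Δ)
      (fun x y => decide (x ≤ y)) (by fun_prop) (by simp)
  · simpa using TraversalInstance.decidableInPolyTime (F := F) (Δ := Δ)
      (fun x y => decide (1 ≤ x) && decide (x ≤ y)) (by fun_prop) (by simp)
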